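/- Let $\mathbb H^n=\{(x,y): x\in\mathbb R^{n-1},\,y>0\}$ with metric $(|dx|^2+dy^2)/y^2$, and consider the Riemannian product $\mathbb H^n\times\mathbb R$ with height coordinate $t$; write $P_h=\mathbb H^n\times\{h\}$. For a hypersurface $\Sigma$ with unit normal $N$, let $k_1,\dots,k_n$ be its principal curvatures (the eigenvalues of $A=-\overline\nabla N$) and $\theta=\langle N,\partial_t\rangle$ its angle function. It is convex if, for a suitable choice of $N$, all $k_i\ge 0$ everywhere, and it is strictly convex at a point if, for a suitable $N$, all $k_i>0$ there. It is a $(c,W_S)$-hypersurface if $\sum_{i\ne j}k_ik_j-(n-1)(2\theta^2+n-2)=c$; by the Gauss equation the left-hand side is its scalar curvature (the sum of the sectional curvatures over ordered pairs of distinct vectors of an orthonormal frame). The parabolic translations considered are $(x,y,t)\mapsto(x+v,y,t)$, $v\in\mathbb R^{n-1}$; they preserve the horospheres $\{y=a\}$. **Theorem.** Let $n\ge 3$. For each $c\in[-n(n-1),0)$ there are two distinct smooth, properly embedded hypersurfaces $\Sigma_1(c)$ and $\Sigma_2(c)$ of $\mathbb H^n\times\mathbb R$ which are homeomorphic to $\mathbb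 R^n$, invariant under all these parabolic translations, and are $(c,W_S)$-hypersurfaces, i.e. have constant scalar curvature $c$. Moreover: (i) $\Sigma_1(c)$ is a convex, nowhere strictly convex, entire graph over $\mathbb H^n$, with constant sectional curvature $K=c/(n(n-1))\in[-1,0)$ and constant angle function. For $c=-n(n-1)$, $\Sigma_1(c)$ is a totally geodesic horizontal hyperplane of constant sectional curvature $-1$. (ii) $\Sigma_2(c)$ is symmetric with respect to $\mathbb H^n\times\{0\}$. If $c>-n(n-1)$, its height function is unbounded above and below. If $c=-n(n-1)$, $\Sigma_2(c)$ is contained in the slab $\mathbb H^n\times(-\pi/n,\pi/n)$ and is asymptotic to $P_{\pi/n}$ and $P_{-\pi/n}$: each of the parts $\{t>0\}$ and $\{t<0\}$ of $\Sigma_2(c)$ lies over all points of $\mathbb H^n$ outside some horoball $\{y\ge\delta\}$, and its height converges uniformly to $\pi/n$, respectively $-\pi/n$, as $y\to0$ (that is, as the distance to the horosphere $\{y=1\}$ goes to infinity outside its horoball). Furthermore, these hypersurfaces can be chosen so that, as $c\to0^-$, both $\Sigma_1(c)$ and $\Sigma_2(c)$ converge to one and the same flat cylinder $\mathscr H_0\times\mathbb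 R$ over a horosphere $\mathscr H_0=\{y=a\}$ of $\mathbb H^n$, smoothly on compact sets: within any compact subset of $\mathbb H^n\times\mathbb R$ they are, for $c$ close enough to $0$, normal graphs over $\mathscr H_0\times\mathbb R$ of smooth functions that tend to zero, with all their derivatives, locally uniformly. -/

import Mathlib

open scoped ContDiff Topology

noncomputable section

namespace HxR

/-! ### Riemannian geometry in coordinates

A Riemannian metric on an open set of `ι → ℝ` is given by its matrix `g p` at each point `p`. -/

section Coordinates

variable {ι : Type*} [Fintype ι] [DecidableEq ι]

/-- The partial derivative `∂f/∂xᵢ` at `p`. -/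
def pderiv (i : ι) (f : (ι → ℝ) → ℝ) (p : ι → ℝ) : ℝ :=
  fderiv ℝ f p (Pi.single i 1)

/-- The inner product `⟨v, w⟩` of tangent vectors at `p`. -/
def metricInner (g : (ι → ℝ) → Matrix ι ι ℝ) (p v w : ι → ℝ) : ℝ :=
  ∑ i, ∑ j, g p i j * v i * w j

/-- The Christoffel symbol `Γᵏᵢⱼ` of the Levi-Civita connection. -/
def christoffel (g : (ι → ℝ) → Matrix ι ι ℝ) (k i j : ι) (p : ι → ℝ) : ℝ :=
  (1 / 2) * ∑ l, (g p)⁻¹ k l *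
    (pderiv i (fun q => g q j l) p + pderiv j (fun q => g q i l) p
      - pderiv l (fun q => g q i j) p)

/-- The covariant derivative `∇_v N` at `p` of a vector field `N`. -/
def covDeriv (g : (ι → ℝ) → Matrix ι ι ℝ) (p v : ι → ℝ) (N : (ι → ℝ) → (ι → ℝ)) : ι → ℝ :=
  fun k => fderiv ℝ N p v k + ∑ i, ∑ j, christoffel g k i j p * v i * N p j

/-- The component along `∂ₗ` of `R(∂ᵢ, ∂ⱼ)∂ₖ`, where
`R(X, Y)Z = ∇_X ∇_Y Z - ∇_Y ∇_X Z - ∇_[X,Y] Z`. -/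
def riemann (g : (ι → ℝ) → Matrix ι ι ℝ) (l k i j : ι) (p : ι → ℝ) : ℝ :=
  pderiv i (christoffel g l j k) p - pderiv j (christoffel g l i k) p
    + ∑ m, (christoffel g l i m p * christoffel g m j k p
      - christoffel g l j m p * christoffel g m i k p)

/-- The vector `R(v, w)z` at `p`. -/
def curvatureOp (g : (ι → ℝ) → Matrix ι ι ℝ) (p v w z : ι → ℝ) : ι → ℝ :=
  fun l => ∑ i, ∑ j, ∑ k, riemann g l k i j p * v i * w j * z k

/-- The sectional curvature of the plane spanned by the linearly independent vectors `v, w`. -/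
def sectionalCurvature (g : (ι → ℝ) → Matrix ι ι ℝ) (p v w : ι → ℝ) : ℝ :=
  metricInner g p (curvatureOp g p v w w) v /
    (metricInner g p v v * metricInner g p w w - metricInner g p v w ^ 2)

/-- The (non-normalized) scalar curvature `gʲᵏ Rⁱₖᵢⱼ`, that is, the trace of the Ricci tensor;
in an orthonormal frame it is the sum of the sectional curvatures `K(eᵢ, eⱼ)`, `i ≠ j`. -/
def scalarCurvature (g : (ι → ℝ) → Matrix ι ι ℝ) (p : ι → ℝ) : ℝ :=
  ∑ j, ∑ k, (g p)⁻¹ j k * ∑ i, riemann g i k i j p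

end Coordinates

/-! ### The ambient space `ℍⁿ × ℝ`

`ℍⁿ` is the upper half-space model; the coordinate with index `0` is the positive one.
A point of `ℍⁿ × ℝ` has the coordinates `p (some i)` of its projection to `ℍⁿ` and the
height `p none`. -/

/-- The coordinate space containing `ℍⁿ × ℝ`. -/
abbrev Amb (n : ℕ) : Type := Option (Fin n) → ℝ

/-- The point `(q, t)`. -/
def pt {n : ℕ} (q : Fin n → ℝ) (t : ℝ) : Amb n := fun o => o.elim t q

/-- The half-space model of `ℍⁿ`. -/
def hypSpace (n : ℕ) [NeZero n] : Set (Fin n → ℝ) := {q | 0 < q 0}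

/-- The product `ℍⁿ × ℝ`. -/
def ambient (n : ℕ) [NeZero n] : Set (Amb n) := {p | 0 < p (some 0)}

/-- The product metric `(dx₁² + ⋯ + dxₙ₋₁² + dy²) / y² + dt²`, where `y` is the coordinate `0`. -/
def ambMetric (n : ℕ) [NeZero n] (p : Amb n) : Matrix (Option (Fin n)) (Option (Fin n)) ℝ :=
  Matrix.diagonal fun o => o.elim 1 fun _ => 1 / p (some 0) ^ 2

/-- The vertical field `∂ₜ`. -/
def vert (n : ℕ) : Amb n := Pi.single none 1

/-- The horizontal hyperplane `P_h = ℍⁿ × {h}`. -/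
def horizontalHyperplane (n : ℕ) [NeZero n] (h : ℝ) : Set (Amb n) :=
  {p | p ∈ ambient n ∧ p none = h}

/-- The cylinder `𝓗 × ℝ` over the horosphere `𝓗 = {y = a}`, `a > 0`, centred at the point at
infinity `∞` of the half-space model. -/
def horocylinder (n : ℕ) [NeZero n] (a : ℝ) : Set (Amb n) := {p | p (some 0) = a}

/-! ### Hypersurfaces -/

variable {n : ℕ} [NeZero n]

/-- `X` restricted to the open set `U ⊆ ℝⁿ` is a smooth local parametrization of `S`:
an immersion and a homeomorphism onto a relatively open subset of `S`. -/
structure IsLocalParam (S : Set (Amb n)) (U : Set (Fin n → ℝ)) (X : (Fin n → ℝ) → Amb n) :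
    Prop where
  isOpen : IsOpen U
  smooth : ContDiffOn ℝ ∞ X U
  immersion : ∀ u ∈ U, Function.Injective (fderiv ℝ X u)
  embedding : Topology.IsEmbedding fun u : U => X u
  image_open : ∃ W : Set (Amb n), IsOpen W ∧ X '' U = S ∩ W

/-- Smooth embedded hypersurfaces of `ℍⁿ × ℝ` whose inclusion is a proper map. -/
structure IsProperlyEmbeddedHypersurface (S : Set (Amb n)) : Prop where
  subset : S ⊆ ambient n
  param : ∀ p ∈ S, ∃ U X, IsLocalParam S U X ∧ p ∈ X '' U
  proper : ∀ K : Set (Amb n), K ⊆ ambient n → IsCompact K → IsCompact (S ∩ K)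

/-- The metric induced on the domain of a parametrization `X`. -/
def inducedMetric (X : (Fin n → ℝ) → Amb n) (u : Fin n → ℝ) : Matrix (Fin n) (Fin n) ℝ :=
  Matrix.of fun i j => metricInner (ambMetric n) (X u)
    (fderiv ℝ X u (Pi.single i 1)) (fderiv ℝ X u (Pi.single j 1))

/-- `S`, with the induced metric, has constant scalar curvature `c`. The scalar curvature at a
point does not depend on the parametrization in which it is computed. -/
def HasConstScalarCurvature (S : Set (Amb n)) (c : ℝ) : Prop :=
  ∀ p ∈ S, ∃ U X, IsLocalParam S U X ∧ ∃ u ∈ U, X u = p ∧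
    scalarCurvature (inducedMetric X) u = c

/-- `S`, with the induced metric, has constant sectional curvature `κ`. -/
def HasConstSectionalCurvature (S : Set (Amb n)) (κ : ℝ) : Prop :=
  ∀ p ∈ S, ∃ U X, IsLocalParam S U X ∧ ∃ u ∈ U, X u = p ∧
    ∀ v w : Fin n → ℝ, LinearIndependent ℝ ![v, w] →
      sectionalCurvature (inducedMetric X) u v w = κ

/-- `v` is the velocity at `p` of a curve lying in `S`. -/
def IsTangent (S : Set (Amb n)) (p v : Amb n) : Prop :=
  ∃ γ : ℝ → Amb n, γ 0 = p ∧ (∀ᶠ s in 𝓝 0, γ s ∈ S) ∧ HasDerivAt γ v 0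

/-- `N` is a smooth unit normal field of `S` (smoothly extended to a neighbourhood of `S`, in
order that it can be differentiated; only its values on `S` matter). -/
structure IsUnitNormal (S : Set (Amb n)) (N : Amb n → Amb n) : Prop where
  smooth : ∃ W : Set (Amb n), IsOpen W ∧ S ⊆ W ∧ ContDiffOn ℝ ∞ N W
  unit : ∀ p ∈ S, metricInner (ambMetric n) p (N p) (N p) = 1
  normal : ∀ p ∈ S, ∀ v, IsTangent S p v → metricInner (ambMetric n) p (N p) v = 0

/-- The shape operator `A v = -∇_v N`. -/
def shape (N : Amb n → Amb n) (p v : Amb n) : Amb n := -covDeriv (ambMetric n) p v N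

/-- The angle function `⟨N, ∂ₜ⟩`. -/
def angle (N : Amb n → Amb n) (p : Amb n) : ℝ := metricInner (ambMetric n) p (N p) (vert n)

/-- `k` is an eigenvalue of the shape operator of `S` at `p`. -/
def IsPrincipalCurvature (S : Set (Amb n)) (N : Amb n → Amb n) (p : Amb n) (k : ℝ) : Prop :=
  ∃ v, IsTangent S p v ∧ v ≠ 0 ∧ shape N p v = k • v

/-- For a suitable orientation all principal curvatures are nonnegative everywhere. -/
def IsConvexHypersurface (S : Set (Amb n)) : Prop :=
  ∃ N, IsUnitNormal S N ∧ ∀ p ∈ S, ∀ k, IsPrincipalCurvature S N p k → 0 ≤ k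

/-- At no point, and for no orientation, are all principal curvatures positive. -/
def IsNowhereStrictlyConvex (S : Set (Amb n)) : Prop :=
  ∀ p ∈ S, ∀ N, IsUnitNormal S N → ¬ ∀ k, IsPrincipalCurvature S N p k → 0 < k

/-- The shape operator vanishes identically. -/
def IsTotallyGeodesic (S : Set (Amb n)) : Prop :=
  ∃ N, IsUnitNormal S N ∧ ∀ p ∈ S, ∀ v, IsTangent S p v → shape N p v = 0

def HasConstAngle (S : Set (Amb n)) : Prop :=
  ∃ N, IsUnitNormal S N ∧ ∃ θ : ℝ, ∀ p ∈ S, angle N p = θ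

/-- The Weingarten function `W_S(k₁, …, kₙ, θ²) = 2 H₂ - (n - 1) (2 θ² + n - 2)` of `ℍⁿ × ℝ`,
where `2 H₂ = ∑_{i ≠ j} kᵢ kⱼ` and the last argument stands for `θ²`. -/
def weingartenS (k : Fin n → ℝ) (θsq : ℝ) : ℝ :=
  (∑ i, ∑ j, if i = j then 0 else k i * k j) - ((n : ℝ) - 1) * (2 * θsq + (n : ℝ) - 2)

/-- `S` is a `(c, W_S)`-hypersurface: its principal curvatures `k₁, …, kₙ` (listed by means of an
orthonormal frame of principal directions) and its angle function `θ` satisfy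
`W_S(k₁, …, kₙ, θ²) = c`. -/
def IsWeingartenS (S : Set (Amb n)) (c : ℝ) : Prop :=
  ∃ N, IsUnitNormal S N ∧ ∀ p ∈ S, ∃ (e : Fin n → Amb n) (k : Fin n → ℝ),
    (∀ i, IsTangent S p (e i)) ∧
    (∀ i j, metricInner (ambMetric n) p (e i) (e j) = if i = j then 1 else 0) ∧
    (∀ i, shape N p (e i) = k i • e i) ∧
    weingartenS k (angle N p ^ 2) = c

/-- Invariance under all parabolic translations `(x, y, t) ↦ (x + v, y, t)`, `v ∈ ℝⁿ⁻¹`; they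
leave invariant every horosphere centred at the point at infinity `∞`. -/
def IsParabolicInvariant (S : Set (Amb n)) : Prop :=
  ∀ v : Fin n → ℝ, v 0 = 0 → ∀ p, p ∈ S ↔ p + pt v 0 ∈ S

/-- `S` is the graph of a smooth function on the whole of `ℍⁿ`. -/
def IsEntireGraph (S : Set (Amb n)) : Prop :=
  ∃ f : (Fin n → ℝ) → ℝ, ContDiffOn ℝ ∞ f (hypSpace n) ∧
    S = (fun q => pt q (f q)) '' hypSpace n

/-- Symmetry with respect to `ℍⁿ × {0}`. -/
def IsSymmetricHorizontal (S : Set (Amb n)) : Prop :=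
  ∀ (q : Fin n → ℝ) (t : ℝ), pt q t ∈ S ↔ pt q (-t) ∈ S

/-- The part `E` of a hypersurface is asymptotic to `P_h`: it lies over all the points of `ℍⁿ`
outside some horoball `{y ≥ δ}`, and its height over such points tends to `h`, uniformly,
as their distance `log (1 / y)` to the horosphere `{y = 1}` tends to infinity. -/
def IsAsymptoticTo (E : Set (Amb n)) (h : ℝ) : Prop :=
  ∀ ε > 0, ∃ δ > 0, ∀ q ∈ hypSpace n, q 0 < δ →
    (∃ t, pt q t ∈ E) ∧ ∀ t, pt q t ∈ E → |t - h| < ε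

/-- Coordinates `(x, t)` on a horocylinder. -/
abbrev CylCoord (n : ℕ) [NeZero n] : Type := ({i : Fin n // i ≠ 0} → ℝ) × ℝ

/-- The normal graph of `u` over the horocylinder `{y = a}`: the signed distance of a point to
`{y = a}` is `log (y / a)`, and its foot point has the same coordinates `x`, `t`. -/
def normalGraph (a : ℝ) (u : CylCoord n → ℝ) : Set (Amb n) :=
  {p | p ∈ ambient n ∧ Real.log (p (some 0) / a) = u (fun i => p (some i.1), p none)}

/-- As `c → 0⁻`, the hypersurfaces `S c` converge to the horocylinder `{y = a}`, smoothly on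
compact sets: within any compact set they are eventually normal graphs of functions `u c` that,
with all their derivatives, tend to zero locally uniformly. -/
def ConvergesToHorocylinder (S : ℝ → Set (Amb n)) (a : ℝ) : Prop :=
  ∃ u : ℝ → CylCoord n → ℝ,
    (∀ K : Set (Amb n), K ⊆ ambient n → IsCompact K →
      ∀ᶠ c in 𝓝[<] (0 : ℝ), S c ∩ K = normalGraph a (u c) ∩ K) ∧
    (∀ᶠ c in 𝓝[<] (0 : ℝ), ContDiff ℝ ∞ (u c)) ∧
    ∀ k : ℕ, TendstoLocallyUniformly (fun c => iteratedFDeriv ℝ k (u c)) 0 (𝓝[<] (0 : ℝ))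

end HxR

end

noncomputable section

namespace HxR

open Filter

/-! ### Curvature of the warped metric `ds² + e^{-2r(s)} |dx|²` -/

section Warped

variable {n : ℕ} [NeZero n]

/-! A hypersurface invariant under the parabolic translations is swept out by a curve in the
half-plane of `(r, t)` with `r = log y`. When this curve has unit speed, the induced metric is `ds²
+ e^{-2r}|dx|²`, whose planes containing `∂_s` have curvature `r'' - r'²` and whose planes
orthogonal to `∂_s` have curvature `-r'²`. Constant scalar curvature `c` is therefore the equation
`2(n-1)r'' - n(n-1)r'² = c`. Writing `c = -n(n-1)κ²`, it becomes the Riccati equation `r'' =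
(n/2)(r'² - κ²)`. Extrinsically, the principal curvatures are the curvature of the profile (once)
and `t'` (`n-1` times), and the angle is `-r'`. The Weingarten condition turns into the same
equation (`Profile.isWeingartenS`).

Two solutions give the two families. The equilibrium `r' = κ` gives a straight line (`lineProfile`),
hence constant curvature `-κ²`, a constant angle and one zero principal curvature. The solution `r'
= -κ tanh(nκs/2)` gives a symmetric profile (`symR`) with `t' = √(1 - r'²)`. For `κ < 1` this speed
is at least `√(1 - κ²)`, so the height is unbounded. For `κ = 1` it is `sech(ns/2)`, and the height
`(2/n) arctan(sinh(ns/2))` tends to `±π/n`.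

The global retraction `G` required of a `Profile` yields embeddedness, properness and a smooth
extension of the normal field together (`Profile.isProperlyEmbedded`, `Profile.smooth_normal`).

For the limit `c → 0⁻`, a profile with `κ < 1` is rewritten as a graph `r = R(t)`. Its slope `q`
solves an autonomous equation with parameter `κ`, so every derivative of `R` is a fixed smooth
function of `(κ, q)` vanishing at the origin (`exists_iteratedDeriv_eq`). Since `|q| ≤ κ/√(1 - κ²)`,
the slope tends to zero uniformly, and all higher derivatives follow. Both families pass through `r
= t = 0`, hence the common limit `{y = 1}`. -/

/-- The warped product metric `ds² + e^{-2r(s)} |dx|²`, where `s` is the coordinate `0`. -/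
def warpedMetric (r : ℝ → ℝ) (u : Fin n → ℝ) : Matrix (Fin n) (Fin n) ℝ :=
  Matrix.diagonal fun i => if i = 0 then 1 else Real.exp (-(2 * r (u 0)))

lemma warpedMetric_apply (r : ℝ → ℝ) (u : Fin n → ℝ) (i j : Fin n) :
    warpedMetric r u i j = if i = j then if i = 0 then 1 else Real.exp (-(2 * r (u 0))) else 0 := by
  simp [warpedMetric, Matrix.diagonal_apply]

lemma warpedMetric_inv (r : ℝ → ℝ) (u : Fin n → ℝ) :
    (warpedMetric r u)⁻¹ =
      Matrix.diagonal fun i => if i = 0 then 1 else Real.exp (2 * r (u 0)) := by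
  apply Matrix.inv_eq_right_inv
  rw [warpedMetric, Matrix.diagonal_mul_diagonal, ← Matrix.diagonal_one]
  congr 1
  funext i
  split_ifs
  · simp
  · rw [← Real.exp_add]; simp

lemma pderiv_comp_coord {f : ℝ → ℝ} {f' : ℝ} {u : Fin n → ℝ} (hf : HasDerivAt f f' (u 0))
    (i : Fin n) : pderiv i (fun v => f (v 0)) u = if i = 0 then f' else 0 := by
  have h : HasFDerivAt (fun v : Fin n → ℝ => f (v 0))
      (f' • (ContinuousLinearMap.proj 0 : (Fin n → ℝ) →L[ℝ] ℝ)) u :=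
    hf.comp_hasFDerivAt u (hasFDerivAt_apply 0 u)
  rw [pderiv, h.fderiv]
  simp [Pi.single_apply, eq_comm]

lemma pderiv_warpedMetric {r : ℝ → ℝ} (hr : Differentiable ℝ r) (u : Fin n → ℝ)
    (i j l : Fin n) :
    pderiv i (fun q => warpedMetric r q j l) u =
      if i = 0 ∧ j = l ∧ j ≠ 0 then -2 * deriv r (u 0) * Real.exp (-(2 * r (u 0))) else 0 := by
  have hE : HasDerivAt (fun s => Real.exp (-(2 * r s)))
      (-2 * deriv r (u 0) * Real.exp (-(2 * r (u 0)))) (u 0) := by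
    convert ((hr (u 0)).hasDerivAt.const_mul 2).fun_neg.exp using 1
    ring
  simp only [warpedMetric_apply]
  by_cases hjl : j = l
  · by_cases hj : j = 0
    · simp [hj, pderiv]
    · have := pderiv_comp_coord hE i
      simpa [hjl, show l ≠ 0 from hjl ▸ hj] using this
  · simp [hjl, pderiv]

/-- Only the derivative along coordinate `0` of a diagonal metric survives. The equality is one of
functions because `riemann` differentiates the symbols. -/
lemma christoffel_warpedMetric {r : ℝ → ℝ} (hr : Differentiable ℝ r) (k i j : Fin n) :
    christoffel (warpedMetric r) k i j = fun u : Fin n → ℝ =>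
      (if k = 0 then
        if i = j ∧ i ≠ 0 then deriv r (u 0) * Real.exp (-(2 * r (u 0))) else 0
      else if (i = 0 ∧ j = k) ∨ (j = 0 ∧ i = k) then -deriv r (u 0) else 0) := by
  funext u
  have hE : Real.exp (2 * r (u 0)) * Real.exp (-(2 * r (u 0))) = 1 := by
    rw [← Real.exp_add]; simp
  simp only [christoffel, pderiv_warpedMetric hr, warpedMetric_inv, Matrix.diagonal_apply,
    ite_mul, zero_mul, Finset.sum_ite_eq, Finset.mem_univ, if_true]
  by_cases hk : k = 0 <;> by_cases hi : i = 0 <;> by_cases hj : j = 0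
  · simp [hk, hi, hj]
  · simp [hk, hi, hj, Ne.symm hj]
  · simp [hk, hi, hj]
  · by_cases hij : i = j
    · subst hij
      simp [hk, hi]; ring
    · simp [hk, hi, hj, hij]
  · simp [hk, hi, hj, Ne.symm hk]
  · by_cases hjk : j = k
    · subst hjk
      simp [hi, hj]; linear_combination (deriv r (u 0)) * hE
    · simp [hk, hi, hj, hjk]
  · by_cases hik : i = k
    · subst hik
      simp [hi, hj]; linear_combination (deriv r (u 0)) * hE
    · simp [hk, hi, hj, hik]
  · simp [hk, hi, hj]

/-- The first summand is the curvature tensor of constant curvature `-r'²`; the `r''` term corrects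
exactly the planes containing `∂_s`. Isolating it makes the case `r'' = 0` immediate. -/
lemma riemann_warpedMetric {r : ℝ → ℝ} (hr : ContDiff ℝ ∞ r) (l k i j : Fin n) (u : Fin n → ℝ) :
    riemann (warpedMetric r) l k i j u =
      -deriv r (u 0) ^ 2 * ((if l = i then warpedMetric r u j k else 0)
        - (if l = j then warpedMetric r u i k else 0))
      + deriv (deriv r) (u 0) *
        ((if j = 0 ∧ k = 0 ∧ l = i then 1 else 0) - (if i = 0 ∧ k = 0 ∧ l = j then 1 else 0)
          + (if i = 0 ∧ l = 0 then warpedMetric r u j k else 0)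
          - (if j = 0 ∧ l = 0 then warpedMetric r u i k else 0)) := by
  have hd : Differentiable ℝ r := hr.differentiable (by simp)
  have hd2 : HasDerivAt (deriv r) (deriv (deriv r) (u 0)) (u 0) :=
    (((contDiff_infty_iff_deriv.1 hr).2.differentiable (by simp)) (u 0)).hasDerivAt
  have hE : HasDerivAt (fun s => deriv r s * Real.exp (-(2 * r s)))
      ((deriv (deriv r) (u 0) - 2 * deriv r (u 0) ^ 2) * Real.exp (-(2 * r (u 0)))) (u 0) := by
    refine (hd2.fun_mul ((hd (u 0)).hasDerivAt.const_mul 2).fun_neg.exp).congr_deriv ?_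
    ring
  have hP : ∀ a b c d : Fin n, pderiv a (christoffel (warpedMetric r) b c d) u =
      if a = 0 then (if b = 0 then
        if c = d ∧ c ≠ 0 then
          (deriv (deriv r) (u 0) - 2 * deriv r (u 0) ^ 2) * Real.exp (-(2 * r (u 0))) else 0
      else if (c = 0 ∧ d = b) ∨ (d = 0 ∧ c = b) then -deriv (deriv r) (u 0) else 0) else 0 := by
    intro a b c d
    rw [christoffel_warpedMetric hd]
    by_cases hb : b = 0
    · by_cases hc : c = d ∧ c ≠ 0
      · rw [if_pos hb, if_pos hc]
        simp only [hb, if_pos hc, if_true]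
        exact pderiv_comp_coord hE a
      · simp [hb, hc, pderiv]
    · by_cases hc : (c = 0 ∧ d = b) ∨ (d = 0 ∧ c = b)
      · simp only [hb, hc, if_true, if_false]
        exact pderiv_comp_coord hd2.neg a
      · simp [hb, hc, pderiv]
  -- At most one intermediate index `m` contributes: `b`, `a` or `0`, according to which of `a` and
  -- `b` vanish.
  have hS : ∀ a b c d : Fin n, ∑ m, christoffel (warpedMetric r) a b m u *
      christoffel (warpedMetric r) m c d u =
      -deriv r (u 0) ^ 2 * (if a = 0 then
        if b ≠ 0 ∧ ((c = 0 ∧ d = b) ∨ (d = 0 ∧ c = b)) then Real.exp (-(2 * r (u 0))) else 0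
      else if b = 0 then (if (c = 0 ∧ d = a) ∨ (d = 0 ∧ c = a) then -1 else 0)
      else if a = b ∧ c = d ∧ c ≠ 0 then Real.exp (-(2 * r (u 0))) else 0) := by
    intro a b c d
    simp only [christoffel_warpedMetric hd]
    by_cases ha : a = 0
    · by_cases hb : b = 0
      · simp [ha, hb]
      · rw [Finset.sum_eq_single b]
        · simp [ha, hb]; split_ifs <;> ring
        · intro m _ hm; simp [ha, Ne.symm hm]
        · simp
    · by_cases hb : b = 0
      · rw [Finset.sum_eq_single a]
        · simp [ha, hb]; split_ifs <;> ring
        · intro m _ hm; simp [ha, hb, hm, Ne.symm ha]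
        · simp
      · rw [Finset.sum_eq_single 0]
        · simp [ha, hb]
          by_cases hab : b = a
          · simp [hab]; split_ifs <;> ring
          · simp [hab, Ne.symm hab]
        · intro m _ hm; simp [ha, hb, hm]
        · simp
  rw [riemann, hP, hP, Finset.sum_sub_distrib, hS, hS]
  simp only [warpedMetric_apply]
  generalize Real.exp (-(2 * r (u 0))) = E
  generalize deriv (deriv r) (u 0) = p'
  generalize deriv r (u 0) = p
  by_cases hl : l = 0 <;> by_cases hi : i = 0 <;> by_cases hj : j = 0 <;> by_cases hk : k = 0 <;>
    simp [hl, hi, hj, hk, Ne.symm, eq_comm] <;> split_ifs <;> first | ring1 | grind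

lemma scalarCurvature_warpedMetric {r : ℝ → ℝ} (hr : ContDiff ℝ ∞ r) (u : Fin n → ℝ) :
    scalarCurvature (warpedMetric r) u =
      2 * ((n : ℝ) - 1) * deriv (deriv r) (u 0) - n * ((n : ℝ) - 1) * deriv r (u 0) ^ 2 := by
  have hRic : ∀ j k, ∑ i, riemann (warpedMetric r) i k i j u =
      -((n : ℝ) - 1) * deriv r (u 0) ^ 2 * warpedMetric r u j k
      + deriv (deriv r) (u 0) *
        (((n : ℝ) - 2) * (if j = 0 ∧ k = 0 then 1 else 0) + warpedMetric r u j k) := by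
    intro j k
    simp only [riemann_warpedMetric hr, Finset.sum_add_distrib, ← Finset.mul_sum,
      Finset.sum_sub_distrib, if_true, Finset.sum_const, Finset.card_univ, Fintype.card_fin,
      nsmul_eq_mul, Finset.sum_ite_eq', Finset.mem_univ, and_true, and_self]
    have h1 : ∑ i : Fin n, (if i = 0 ∧ k = 0 ∧ i = j then (1 : ℝ) else 0) =
        if j = 0 ∧ k = 0 then 1 else 0 := by
      rw [Finset.sum_eq_single j]
      · simp
      · intro i _ hi; simp [hi]
      · simp
    have h2 : ∑ i : Fin n, (if j = 0 ∧ i = 0 then warpedMetric r u i k else 0) =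
        if j = 0 ∧ k = 0 then 1 else 0 := by
      rw [Finset.sum_eq_single 0]
      · by_cases hj : j = 0 <;> by_cases hk : k = 0 <;>
          simp [warpedMetric_apply, hj, hk, eq_comm (a := (0 : Fin n))]
      · intro i _ hi; simp [hi]
      · simp
    rw [h1, h2]
    ring
  have hE : Real.exp (2 * r (u 0)) * Real.exp (-(2 * r (u 0))) = 1 := by
    rw [← Real.exp_add]; simp
  -- Diagonal Ricci terms after raising an index: all directions share one value, and the direction
  -- `∂_s` has `(n-2)r''` in addition.
  have h3 : ∀ j : Fin n, (if j = 0 then 1 else Real.exp (2 * r (u 0))) *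
      (-((n : ℝ) - 1) * deriv r (u 0) ^ 2 * warpedMetric r u j j
      + deriv (deriv r) (u 0) *
        (((n : ℝ) - 2) * (if j = 0 ∧ j = 0 then 1 else 0) + warpedMetric r u j j)) =
      (deriv (deriv r) (u 0) - ((n : ℝ) - 1) * deriv r (u 0) ^ 2) +
        if j = 0 then ((n : ℝ) - 2) * deriv (deriv r) (u 0) else 0 := by
    intro j
    by_cases hj : j = 0
    · simp [hj, warpedMetric_apply]; ring
    · simp [hj, warpedMetric_apply]
      linear_combination (deriv (deriv r) (u 0) - ((n : ℝ) - 1) * deriv r (u 0) ^ 2) * hE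
  simp only [scalarCurvature, hRic, warpedMetric_inv, Matrix.diagonal_apply, ite_mul, zero_mul,
    Finset.sum_ite_eq, Finset.mem_univ, if_true]
  simp only [← ite_mul, h3, Finset.sum_add_distrib, Finset.sum_const, Finset.card_univ,
    Fintype.card_fin, nsmul_eq_mul, Finset.sum_ite_eq', Finset.mem_univ, if_true]
  ring

end Warped

/-! ### Diagonal inner products and the strict Cauchy-Schwarz inequality. -/

section Inner

variable {ι : Type*} [Fintype ι] [DecidableEq ι]

lemma metricInner_diagonal {g : (ι → ℝ) → Matrix ι ι ℝ} {p d : ι → ℝ}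
    (h : g p = Matrix.diagonal d) (v w : ι → ℝ) :
    metricInner g p v w = ∑ i, d i * v i * w i := by
  simp [metricInner, h, Matrix.diagonal_apply]

end Inner

/-- With `a = |v|²`, `b = |w|²`, `c = ⟨v, w⟩`, one has `|a w - c v|² = a(ab - c²)`, so a vanishing
determinant would give a linear relation between `v` and `w`. This keeps the denominator of
`sectionalCurvature` nonzero. -/
lemma cauchy_schwarz_strict_diagonal {ι : Type*} [Fintype ι] {d v w : ι → ℝ} (hd : ∀ i, 0 < d i)
    (hvw : LinearIndependent ℝ ![v, w]) :
    (∑ i, d i * v i * v i) * (∑ i, d i * w i * w i) - (∑ i, d i * v i * w i) ^ 2 ≠ 0 := by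
  intro h
  set a := ∑ i, d i * v i * v i with ha
  set b := ∑ i, d i * w i * w i
  set c := ∑ i, d i * v i * w i with hc
  have hv : v ≠ 0 := hvw.ne_zero 0
  have key : ∑ i, d i * (a * w i - c * v i) ^ 2 = 0 := by
    have : ∑ i, d i * (a * w i - c * v i) ^ 2 = a * (a * b - c ^ 2) := by
      have e : ∀ i, d i * (a * w i - c * v i) ^ 2 = a ^ 2 * (d i * w i * w i)
          - 2 * a * c * (d i * v i * w i) + c ^ 2 * (d i * v i * v i) := fun i => by ring
      simp only [e, Finset.sum_add_distrib, Finset.sum_sub_distrib, ← Finset.mul_sum]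
      simp only [← ha, ← hc]
      ring
    rw [this, h, mul_zero]
  rw [Finset.sum_eq_zero_iff_of_nonneg fun i _ => mul_nonneg (hd i).le (sq_nonneg _)] at key
  have hz : (-c) • v + a • w = 0 := by
    funext i
    have := key i (Finset.mem_univ i)
    rcases mul_eq_zero.1 this with h0 | h0
    · exact absurd h0 (hd i).ne'
    · have := pow_eq_zero_iff (two_ne_zero) |>.1 h0
      simp only [Pi.add_apply, Pi.smul_apply, smul_eq_mul, Pi.zero_apply]
      linarith
  have ha0 : a = 0 := (LinearIndependent.pair_iff.1 hvw _ _ hz).2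
  rw [ha, Finset.sum_eq_zero_iff_of_nonneg
    fun i _ => by rw [mul_assoc]; exact mul_nonneg (hd i).le (mul_self_nonneg _)] at ha0
  apply hv
  funext i
  have := ha0 i (Finset.mem_univ i)
  rw [mul_assoc] at this
  simpa [(hd i).ne'] using this

section Warped

variable {n : ℕ} [NeZero n]

lemma curvatureOp_warpedMetric {r : ℝ → ℝ} (hr : ContDiff ℝ ∞ r) {u : Fin n → ℝ}
    (h0 : deriv (deriv r) (u 0) = 0) (v w z : Fin n → ℝ) :
    curvatureOp (warpedMetric r) u v w z = fun l => -deriv r (u 0) ^ 2 *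
      (metricInner (warpedMetric r) u w z * v l - metricInner (warpedMetric r) u v z * w l) := by
  funext l
  have e1 : metricInner (warpedMetric r) u w z * v l =
      ∑ i, ∑ j, ∑ k, (if l = i then warpedMetric r u j k else 0) * v i * w j * z k := by
    rw [Finset.sum_eq_single l]
    · simp only [metricInner, Finset.sum_mul, if_true]
      exact Finset.sum_congr rfl fun j _ => Finset.sum_congr rfl fun k _ => by ring
    · intro i _ hi; simp [Ne.symm hi]
    · simp
  have e2 : metricInner (warpedMetric r) u v z * w l =
      ∑ i, ∑ j, ∑ k, (if l = j then warpedMetric r u i k else 0) * v i * w j * z k := by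
    rw [Finset.sum_comm, Finset.sum_eq_single l]
    · simp only [metricInner, Finset.sum_mul, if_true]
      exact Finset.sum_congr rfl fun j _ => Finset.sum_congr rfl fun k _ => by ring
    · intro i _ hi; simp [Ne.symm hi]
    · simp
  rw [e1, e2]
  simp only [curvatureOp, riemann_warpedMetric hr, h0, zero_mul, add_zero, Finset.mul_sum,
    ← Finset.sum_sub_distrib]
  exact Finset.sum_congr rfl fun i _ => Finset.sum_congr rfl fun j _ =>
    Finset.sum_congr rfl fun k _ => by ring

lemma sectionalCurvature_warpedMetric {r : ℝ → ℝ} (hr : ContDiff ℝ ∞ r) {u : Fin n → ℝ}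
    (h0 : deriv (deriv r) (u 0) = 0) {v w : Fin n → ℝ} (hvw : LinearIndependent ℝ ![v, w]) :
    sectionalCurvature (warpedMetric r) u v w = -deriv r (u 0) ^ 2 := by
  rw [sectionalCurvature, curvatureOp_warpedMetric hr h0]
  obtain ⟨d, hd, hpos⟩ : ∃ d : Fin n → ℝ, warpedMetric r u = Matrix.diagonal d ∧ ∀ i, 0 < d i :=
    ⟨_, rfl, fun i => by split_ifs; exacts [one_pos, Real.exp_pos _]⟩
  simp only [metricInner_diagonal hd]
  rw [div_eq_iff (cauchy_schwarz_strict_diagonal hpos hvw)]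
  generalize hb : ∑ i, d i * w i * w i = b
  generalize hc : ∑ i, d i * v i * w i = c
  have h1 : ∀ i, d i * (-deriv r (u 0) ^ 2 * (b * v i - c * w i)) * v i =
      -deriv r (u 0) ^ 2 * (b * (d i * v i * v i) - c * (d i * v i * w i)) := fun i => by ring
  simp only [h1, ← Finset.mul_sum, Finset.sum_sub_distrib, hc]
  ring

end Warped

/-! ### The connection of `ℍⁿ × ℝ` -/

section Ambient

variable {n : ℕ} [NeZero n]

lemma pderiv_ambMetric {p : Amb n} (hp : p ∈ ambient n) (i j l : Option (Fin n)) :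
    pderiv i (fun q => ambMetric n q j l) p =
      (-2 / p (some 0) ^ 3) * if i = some 0 ∧ j = l ∧ j ≠ none then 1 else 0 := by
  have hy : p (some 0) ≠ 0 := ne_of_gt hp
  by_cases hjl : j = l
  · subst hjl
    rcases j with _ | j
    · simp [ambMetric, pderiv]
    · have h1 : HasDerivAt (fun s : ℝ => 1 / s ^ 2) (-2 / p (some 0) ^ 3) (p (some 0)) := by
        have := ((hasDerivAt_id (p (some 0))).fun_pow 2).fun_inv (pow_ne_zero 2 hy)
        simp only [one_div]
        refine this.congr_deriv ?_
        simp
        field_simp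
      have h2 : HasFDerivAt (fun q : Amb n => 1 / q (some 0) ^ 2)
          ((-2 / p (some 0) ^ 3) • (ContinuousLinearMap.proj (some 0) : Amb n →L[ℝ] ℝ)) p :=
        h1.comp_hasFDerivAt (f := fun q : Amb n => q (some 0)) p (hasFDerivAt_apply (some 0) p)
      simp only [ambMetric, Matrix.diagonal_apply_eq, Option.elim_some]
      rw [pderiv, h2.fderiv]
      simp [Pi.single_apply, eq_comm]
  · simp [ambMetric, pderiv, hjl]

lemma ambMetric_inv {p : Amb n} (hp : p ∈ ambient n) :
    (ambMetric n p)⁻¹ = Matrix.diagonal fun o => o.elim 1 fun _ => p (some 0) ^ 2 := by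
  have hy : p (some 0) ≠ 0 := ne_of_gt hp
  apply Matrix.inv_eq_right_inv
  rw [ambMetric, Matrix.diagonal_mul_diagonal, ← Matrix.diagonal_one]
  congr 1
  funext o
  rcases o with _ | i
  · simp
  · simp [hy]

/-- A pointwise statement suffices here: the ambient symbols enter the shape operator
undifferentiated. -/
lemma christoffel_ambMetric {p : Amb n} (hp : p ∈ ambient n) (k i j : Option (Fin n)) :
    christoffel (ambMetric n) k i j p = (1 / p (some 0)) *
      ((if k = some 0 ∧ i = j ∧ i ≠ none then 1 else 0)
        - (if k ≠ none ∧ i = some 0 ∧ j = k then 1 else 0)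
        - (if k ≠ none ∧ j = some 0 ∧ i = k then 1 else 0)) := by
  have hy : p (some 0) ≠ 0 := ne_of_gt hp
  simp only [christoffel, pderiv_ambMetric hp, ambMetric_inv hp, Matrix.diagonal_apply,
    ite_mul, zero_mul, Finset.sum_ite_eq, Finset.mem_univ, if_true]
  rcases k with _ | k
  · rcases i with _ | i <;> rcases j with _ | j <;> simp
  · have e : p (some 0) ^ 2 * (-2 / p (some 0) ^ 3) = -2 * (1 / p (some 0)) := by
      field_simp
    rcases i with _ | i <;> rcases j with _ | j
    · simp
    · simp
    · simp
    · simp only [Option.elim_some, ne_eq, reduceCtorEq, not_false_eq_true, and_true, true_and,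
        Option.some.injEq]
      linear_combination (1 / 2) * ((if i = 0 ∧ j = k then 1 else 0) +
        (if j = 0 ∧ i = k then 1 else 0) - (if k = 0 ∧ i = j then 1 else 0)) * e

/-- The vertical factor is flat; conformality of the half-space metric to the Euclidean one gives
the correction `(⟨v,N⟩e₀ - v₀N - N₀v)/y` to the horizontal components, with Euclidean inner product.
-/
lemma covDeriv_ambMetric {p : Amb n} (hp : p ∈ ambient n) (v : Amb n) (N : Amb n → Amb n) :
    covDeriv (ambMetric n) p v N = fun o => fderiv ℝ N p v o + o.elim 0 fun k =>
      (1 / p (some 0)) * ((if k = 0 then ∑ i : Fin n, v (some i) * N p (some i) else 0)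
        - v (some 0) * N p (some k) - N p (some 0) * v (some k)) := by
  funext o
  simp only [covDeriv, christoffel_ambMetric hp]
  congr 1
  rcases o with _ | k
  · simp
  · simp only [Fintype.sum_option]
    simp only [reduceCtorEq, ne_eq, not_true_eq_false, not_false_eq_true, and_true, true_and,
      Option.some.injEq, if_false, sub_zero, mul_zero, zero_mul, Finset.sum_const_zero,
      zero_add, add_zero, and_false, false_and, Option.elim_some]
    have h1 : ∀ i : Fin n, ∑ j : Fin n, 1 / p (some 0) *
        ((if k = 0 ∧ i = j then 1 else 0) - (if i = 0 ∧ j = k then 1 else 0)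
          - (if j = 0 ∧ i = k then 1 else 0)) * v (some i) * N p (some j) =
        1 / p (some 0) * ((if k = 0 then v (some i) * N p (some i) else 0)
          - (if i = 0 then v (some i) * N p (some k) else 0)
          - (if i = k then N p (some 0) * v (some i) else 0)) := by
      intro i
      have e : ∀ j : Fin n, 1 / p (some 0) *
        ((if k = 0 ∧ i = j then 1 else 0) - (if i = 0 ∧ j = k then 1 else 0)
          - (if j = 0 ∧ i = k then 1 else 0)) * v (some i) * N p (some j) =
          (if i = j then if k = 0 then 1 / p (some 0) * v (some i) * N p (some j) else 0 else 0)
          - (if j = k then if i = 0 then 1 / p (some 0) * v (some i) * N p (some j) else 0 else 0)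
          - (if j = 0 then if i = k then 1 / p (some 0) * v (some i) * N p (some j) else 0
              else 0) := by
        intro j
        simp only [← ite_and, and_comm (a := i = j), and_comm (a := j = k)]
        split_ifs <;> ring
      simp only [e, Finset.sum_sub_distrib, Finset.sum_ite_eq, Finset.sum_ite_eq',
        Finset.mem_univ, if_true]
      split_ifs <;> ring
    simp only [h1, ← Finset.mul_sum, Finset.sum_sub_distrib, Finset.sum_ite_eq',
      Finset.mem_univ, if_true]
    by_cases hk : k = 0 <;> simp [hk]

lemma metricInner_ambMetric (p v w : Amb n) :
    metricInner (ambMetric n) p v w = v none * w none +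
      ∑ i, 1 / p (some 0) ^ 2 * v (some i) * w (some i) := by
  rw [metricInner_diagonal (g := ambMetric n) (p := p) rfl, Fintype.sum_option]
  simp

end Ambient

/-! ### Hypersurfaces invariant under parabolic translations -/

/-- A curve `s ↦ (r s, t s)` of unit speed with a smooth global retraction `G` onto its
parameter. -/
structure Profile where
  r : ℝ → ℝ
  t : ℝ → ℝ
  G : ℝ × ℝ → ℝ
  smooth_r : ContDiff ℝ ∞ r
  smooth_t : ContDiff ℝ ∞ t
  smooth_G : ContDiff ℝ ∞ G
  unit_speed : ∀ s, deriv r s ^ 2 + deriv t s ^ 2 = 1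
  left_inv : ∀ s, G (r s, t s) = s

namespace Profile

variable (γ : Profile)

lemma hasDerivAt_r (s : ℝ) : HasDerivAt γ.r (deriv γ.r s) s :=
  (γ.smooth_r.differentiable (by simp) s).hasDerivAt

lemma hasDerivAt_t (s : ℝ) : HasDerivAt γ.t (deriv γ.t s) s :=
  (γ.smooth_t.differentiable (by simp) s).hasDerivAt

lemma smooth_deriv_r : ContDiff ℝ ∞ (deriv γ.r) := (contDiff_infty_iff_deriv.1 γ.smooth_r).2

lemma smooth_deriv_t : ContDiff ℝ ∞ (deriv γ.t) := (contDiff_infty_iff_deriv.1 γ.smooth_t).2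

lemma hasDerivAt_deriv_r (s : ℝ) : HasDerivAt (deriv γ.r) (deriv (deriv γ.r) s) s :=
  (γ.smooth_deriv_r.differentiable (by simp) s).hasDerivAt

lemma hasDerivAt_deriv_t (s : ℝ) : HasDerivAt (deriv γ.t) (deriv (deriv γ.t) s) s :=
  (γ.smooth_deriv_t.differentiable (by simp) s).hasDerivAt

lemma deriv_mul_deriv_deriv (s : ℝ) :
    deriv γ.r s * deriv (deriv γ.r) s + deriv γ.t s * deriv (deriv γ.t) s = 0 := by
  have h1 := ((γ.hasDerivAt_deriv_r s).fun_pow 2).fun_add ((γ.hasDerivAt_deriv_t s).fun_pow 2)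
  have h2 : HasDerivAt (fun s => deriv γ.r s ^ 2 + deriv γ.t s ^ 2) 0 s := by
    simp only [γ.unit_speed]
    exact hasDerivAt_const s 1
  have := h1.unique h2
  norm_num at this
  linarith

/-- The curvature of the profile curve. -/
def curv (s : ℝ) : ℝ := deriv (deriv γ.r) s * deriv γ.t s - deriv (deriv γ.t) s * deriv γ.r s

/-- With `curv_mul_deriv_t`, these are the Frenet equations `r'' = k t'`, `t'' = -k r'` of a
unit-speed plane curve. -/
lemma curv_mul_deriv_r (s : ℝ) : γ.curv s * deriv γ.r s = -deriv (deriv γ.t) s := by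
  rw [curv]
  linear_combination (deriv γ.t s) * γ.deriv_mul_deriv_deriv s
    - deriv (deriv γ.t) s * γ.unit_speed s

lemma curv_mul_deriv_t (s : ℝ) : γ.curv s * deriv γ.t s = deriv (deriv γ.r) s := by
  rw [curv]
  linear_combination (-deriv γ.r s) * γ.deriv_mul_deriv_deriv s
    + deriv (deriv γ.r) s * γ.unit_speed s

variable {n : ℕ} [NeZero n]

/-- The hypersurface swept out by the profile curve under the parabolic translations. -/
def surface (n : ℕ) [NeZero n] : Set (Amb n) :=
  {p | ∃ s, p (some 0) = Real.exp (γ.r s) ∧ p none = γ.t s}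

/-- The global parametrization `(x, s) ↦ (x, e^{r(s)}, t(s))`. -/
def param (u : Fin n → ℝ) : Amb n :=
  fun o => o.elim (γ.t (u 0)) fun i => if i = 0 then Real.exp (γ.r (u 0)) else u i

/-- The derivative of `param`. -/
def dparam (u : Fin n → ℝ) : (Fin n → ℝ) →L[ℝ] Amb n :=
  ContinuousLinearMap.pi fun o =>
    o.elim (deriv γ.t (u 0) • ContinuousLinearMap.proj 0) fun i =>
      if i = 0 then (Real.exp (γ.r (u 0)) * deriv γ.r (u 0)) • ContinuousLinearMap.proj 0
      else ContinuousLinearMap.proj i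

@[simp] lemma param_none (u : Fin n → ℝ) : γ.param u none = γ.t (u 0) := rfl

@[simp] lemma param_zero (u : Fin n → ℝ) : γ.param u (some 0) = Real.exp (γ.r (u 0)) := by
  simp [param]

lemma param_of_ne (u : Fin n → ℝ) {i : Fin n} (hi : i ≠ 0) : γ.param u (some i) = u i := by
  simp [param, hi]

@[simp] lemma dparam_none (u w : Fin n → ℝ) : γ.dparam u w none = deriv γ.t (u 0) * w 0 := rfl

@[simp] lemma dparam_zero (u w : Fin n → ℝ) :
    γ.dparam u w (some 0) = Real.exp (γ.r (u 0)) * deriv γ.r (u 0) * w 0 := by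
  simp [dparam]

lemma dparam_of_ne (u w : Fin n → ℝ) {i : Fin n} (hi : i ≠ 0) :
    γ.dparam u w (some i) = w i := by
  simp [dparam, hi]

lemma smooth_param : ContDiff ℝ ∞ (γ.param (n := n)) := by
  have h0 : ContDiff ℝ ∞ fun u : Fin n → ℝ => u 0 := contDiff_apply ℝ ℝ 0
  refine contDiff_pi.2 fun o => ?_
  rcases o with _ | i
  · exact γ.smooth_t.comp h0
  · by_cases hi : i = 0
    · simpa [param, hi] using (γ.smooth_r.comp h0).exp
    · simpa [param, hi] using contDiff_apply ℝ ℝ i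

lemma hasFDerivAt_param (u : Fin n → ℝ) : HasFDerivAt γ.param (γ.dparam u) u := by
  have h0 : HasFDerivAt (fun u : Fin n → ℝ => u 0)
    (ContinuousLinearMap.proj 0 : (Fin n → ℝ) →L[ℝ] ℝ) u := hasFDerivAt_apply 0 u
  refine hasFDerivAt_pi.2 fun o => ?_
  rcases o with _ | i
  · exact (γ.hasDerivAt_t _).comp_hasFDerivAt (f := fun u : Fin n → ℝ => u 0) u h0
  · by_cases hi : i = 0
    · subst hi
      simpa [param, Function.comp_def] using
        (γ.hasDerivAt_r _).exp.comp_hasFDerivAt (f := fun u : Fin n → ℝ => u 0) u h0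
    · simpa [param, hi] using (hasFDerivAt_apply i u)

lemma fderiv_param (u : Fin n → ℝ) : fderiv ℝ γ.param u = γ.dparam u :=
  (γ.hasFDerivAt_param u).fderiv

lemma param_mem_ambient (u : Fin n → ℝ) : γ.param u ∈ ambient n := by
  simp [ambient, Real.exp_pos]

lemma param_mem_surface (u : Fin n → ℝ) : γ.param u ∈ γ.surface n :=
  ⟨u 0, by simp, rfl⟩

/-- The parameter of a point close to the hypersurface. -/
def parameter (p : Amb n) : ℝ := γ.G (Real.log (p (some 0)), p none)

/-- A left inverse of `param`. -/
def chart (p : Amb n) : Fin n → ℝ := fun i => if i = 0 then γ.parameter p else p (some i)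

@[simp] lemma parameter_param (u : Fin n → ℝ) : γ.parameter (γ.param u) = u 0 := by
  simp [parameter, γ.left_inv]

lemma chart_param (u : Fin n → ℝ) : γ.chart (γ.param u) = u := by
  funext i
  by_cases hi : i = 0
  · simp [chart, hi]
  · simp [chart, hi, γ.param_of_ne u hi]

lemma surface_eq_range : γ.surface n = Set.range γ.param := by
  apply Set.Subset.antisymm
  · rintro p ⟨s, hs, ht⟩
    refine ⟨fun i => if i = 0 then s else p (some i), ?_⟩
    funext o
    rcases o with _ | i
    · simp [ht]
    · by_cases hi : i = 0
      · simp [hi, hs]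
      · simp [γ.param_of_ne _ hi, hi]
  · rintro _ ⟨u, rfl⟩
    exact γ.param_mem_surface u

lemma param_chart {p : Amb n} (hp : p ∈ γ.surface n) : γ.param (γ.chart p) = p := by
  rw [surface_eq_range] at hp
  obtain ⟨u, rfl⟩ := hp
  rw [chart_param]

lemma surface_subset : γ.surface n ⊆ ambient n := by
  rw [surface_eq_range]
  rintro _ ⟨u, rfl⟩
  exact γ.param_mem_ambient u

lemma isOpen_ambient : IsOpen (ambient n) :=
  isOpen_lt continuous_const (continuous_apply _)

lemma smooth_parameter : ContDiffOn ℝ ∞ (γ.parameter (n := n)) (ambient n) := by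
  refine γ.smooth_G.comp_contDiffOn (ContDiffOn.prodMk ?_ ?_)
  · exact (contDiff_apply ℝ ℝ (some 0)).contDiffOn.log fun p hp => ne_of_gt hp
  · exact (contDiff_apply ℝ ℝ none).contDiffOn

lemma smooth_chart : ContDiffOn ℝ ∞ (γ.chart (n := n)) (ambient n) := by
  refine contDiffOn_pi.2 fun i => ?_
  by_cases hi : i = 0
  · simpa [chart, hi] using γ.smooth_parameter
  · simpa [chart, hi] using (contDiff_apply ℝ ℝ (some i)).contDiffOn

lemma isEmbedding_param : Topology.IsEmbedding (γ.param (n := n)) := by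
  -- The map is factored through the half-space because `chart`, which contains `log y`, is known to
  -- be continuous only there.
  let Φ : (Fin n → ℝ) → ambient n := fun u => ⟨γ.param u, γ.param_mem_ambient u⟩
  let Ψ : ambient n → Fin n → ℝ := fun p => γ.chart p
  have hΦ : Continuous Φ := γ.smooth_param.continuous.subtype_mk _
  have hΨ : Continuous Ψ := γ.smooth_chart.continuousOn.domRestrict
  have h : Ψ ∘ Φ = id := funext fun u => γ.chart_param u
  have hemb : Topology.IsEmbedding Φ := .of_comp hΦ hΨ (h ▸ .id)
  exact Topology.IsEmbedding.subtypeVal.comp hemb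

lemma dparam_injective (u : Fin n → ℝ) : Function.Injective (γ.dparam u) := by
  refine (injective_iff_map_eq_zero _).2 fun w hw => ?_
  have h0 : deriv γ.t (u 0) * w 0 = 0 := by simpa using congrFun hw none
  have h1 : Real.exp (γ.r (u 0)) * deriv γ.r (u 0) * w 0 = 0 := by
    simpa using congrFun hw (some 0)
  rw [mul_assoc] at h1
  have h2 := (mul_eq_zero.1 h1).resolve_left (Real.exp_pos _).ne'
  funext i
  by_cases hi : i = 0
  · subst hi
    simp only [Pi.zero_apply]
    linear_combination (-w 0) * γ.unit_speed (u 0) + deriv γ.r (u 0) * h2 + deriv γ.t (u 0) * h0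
  · simpa [γ.dparam_of_ne u w hi] using congrFun hw (some i)

lemma isLocalParam : IsLocalParam (γ.surface n) Set.univ γ.param where
  isOpen := isOpen_univ
  smooth := γ.smooth_param.contDiffOn
  immersion u _ := by rw [fderiv_param]; exact γ.dparam_injective u
  embedding := γ.isEmbedding_param.comp Topology.IsEmbedding.subtypeVal
  image_open := ⟨Set.univ, isOpen_univ, by
    rw [Set.image_univ, Set.inter_univ, surface_eq_range]⟩

lemma isProperlyEmbedded : IsProperlyEmbeddedHypersurface (γ.surface n) where
  subset := γ.surface_subset
  param p hp := ⟨Set.univ, γ.param, γ.isLocalParam, by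
    rw [Set.image_univ, ← surface_eq_range]; exact hp⟩
  proper K hK hc := by
    -- Within the ambient space the hypersurface is the fixed-point set of the continuous retraction
    -- `param ∘ chart`, so it meets compact sets in closed sets.
    have hcont : ContinuousOn (fun p => γ.param (γ.chart p) - p) K :=
      (γ.smooth_param.continuous.comp_continuousOn
        (γ.smooth_chart.continuousOn.mono hK)).sub continuousOn_id
    have hcl := hcont.preimage_isClosed_of_isClosed hc.isClosed (isClosed_singleton (x := 0))
    have : γ.surface n ∩ K = K ∩ (fun p => γ.param (γ.chart p) - p) ⁻¹' {0} := by
      ext p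
      constructor
      · rintro ⟨hp, hpK⟩
        exact ⟨hpK, by simp [γ.param_chart hp]⟩
      · rintro ⟨hpK, hp⟩
        have : γ.param (γ.chart p) = p := sub_eq_zero.1 hp
        exact ⟨this ▸ γ.param_mem_surface _, hpK⟩
    rw [this]
    exact hc.of_isClosed_subset hcl Set.inter_subset_left

lemma homeomorph_euclideanSpace : Nonempty (γ.surface n ≃ₜ EuclideanSpace ℝ (Fin n)) := by
  rw [surface_eq_range]
  exact ⟨γ.isEmbedding_param.toHomeomorph.symm.trans
    (EuclideanSpace.equiv (Fin n) ℝ).symm.toHomeomorph⟩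

lemma isParabolicInvariant : IsParabolicInvariant (γ.surface n) := by
  intro v hv p
  simp [surface, pt, hv]

/-! #### Intrinsic curvature -/

/-- Since `y'/y = r'`, unit speed of `(r, t)` is unit speed in the product metric, while `1/y² =
e^{-2r}` scales the translation directions. -/
lemma metricInner_dparam (u v w : Fin n → ℝ) :
    metricInner (ambMetric n) (γ.param u) (γ.dparam u v) (γ.dparam u w) =
      metricInner (warpedMetric γ.r) u v w := by
  rw [metricInner_ambMetric, metricInner_diagonal (g := warpedMetric γ.r) (p := u) rfl,
    ← Finset.add_sum_erase _ _ (Finset.mem_univ 0), ← Finset.add_sum_erase _ _ (Finset.mem_univ 0)]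
  have hs : ∀ i ∈ Finset.univ.erase (0 : Fin n), 1 / γ.param u (some 0) ^ 2 *
      γ.dparam u v (some i) * γ.dparam u w (some i) =
      (if i = 0 then 1 else Real.exp (-(2 * γ.r (u 0)))) * v i * w i := by
    intro i hi
    have hi := Finset.ne_of_mem_erase hi
    rw [γ.dparam_of_ne u v hi, γ.dparam_of_ne u w hi, if_neg hi, param_zero, ← Real.exp_nat_mul,
      Real.exp_neg, one_div]
    norm_num
  rw [Finset.sum_congr rfl hs, ← add_assoc]
  congr 1
  have := (Real.exp_pos (γ.r (u 0))).ne'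
  simp only [param_zero, dparam_zero, dparam_none, if_true]
  field_simp
  linear_combination (v 0 * w 0) * γ.unit_speed (u 0)

lemma inducedMetric_param : inducedMetric (γ.param (n := n)) = warpedMetric γ.r := by
  funext u
  ext i j
  rw [inducedMetric, Matrix.of_apply, fderiv_param, metricInner_dparam,
    metricInner_diagonal (g := warpedMetric γ.r) (p := u) rfl, warpedMetric_apply]
  by_cases hij : i = j
  · subst hij; simp [Pi.single_apply]
  · simp [Pi.single_apply, hij, Ne.symm hij]

lemma hasConstScalarCurvature {c : ℝ} (hc : ∀ s, 2 * ((n : ℝ) - 1) * deriv (deriv γ.r) s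
      - n * ((n : ℝ) - 1) * deriv γ.r s ^ 2 = c) :
    HasConstScalarCurvature (γ.surface n) c := by
  rw [surface_eq_range]
  rintro _ ⟨u, rfl⟩
  rw [← surface_eq_range]
  refine ⟨_, _, γ.isLocalParam, u, trivial, rfl, ?_⟩
  rw [inducedMetric_param, scalarCurvature_warpedMetric γ.smooth_r, hc]

lemma hasConstSectionalCurvature {a : ℝ} (ha : ∀ s, deriv γ.r s = a) :
    HasConstSectionalCurvature (γ.surface n) (-a ^ 2) := by
  rw [surface_eq_range]
  rintro _ ⟨u, rfl⟩
  rw [← surface_eq_range]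
  refine ⟨_, _, γ.isLocalParam, u, trivial, rfl, fun v w hvw => ?_⟩
  rw [inducedMetric_param, sectionalCurvature_warpedMetric γ.smooth_r ?_ hvw, ha]
  rw [funext ha]; simp

end Profile

namespace Profile

variable (γ : Profile)

lemma sum_ite_ne_mul {ι : Type*} [Fintype ι] [DecidableEq ι] (k : ι → ℝ) :
    (∑ i, ∑ j, if i = j then 0 else k i * k j) = (∑ i, k i) ^ 2 - ∑ i, k i ^ 2 := by
  have h : ∀ i j, (if i = j then 0 else k i * k j) =
      k i * k j - if i = j then k i ^ 2 else 0 := by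
    intro i j
    split_ifs with h
    · subst h; ring
    · ring
  simp only [h, Finset.sum_sub_distrib, Finset.sum_ite_eq, Finset.mem_univ, if_true,
    ← Finset.mul_sum, ← Finset.sum_mul, sq]

variable {n : ℕ} [NeZero n]

/-! #### Extrinsic geometry -/

lemma isTangent_dparam (u w : Fin n → ℝ) : IsTangent (γ.surface n) (γ.param u) (γ.dparam u w) := by
  refine ⟨fun s => γ.param (u + s • w), by simp, .of_forall fun s => γ.param_mem_surface _, ?_⟩
  have h1 : HasDerivAt (fun s : ℝ => u + s • w) w 0 := by
    simpa using ((hasDerivAt_id (0 : ℝ)).smul_const w).const_add u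
  have h2 : HasFDerivAt γ.param (γ.dparam u) (u + (0 : ℝ) • w) := by
    simpa using γ.hasFDerivAt_param u
  exact h2.comp_hasDerivAt 0 h1

/-- A curve staying in the hypersurface equals its image under `param ∘ chart`, so the chain rule
puts its velocity in the range of `dparam`. -/
lemma exists_of_isTangent {u : Fin n → ℝ} {v : Amb n}
    (hv : IsTangent (γ.surface n) (γ.param u) v) : ∃ w, v = γ.dparam u w := by
  obtain ⟨σ, h0, hS, hd⟩ := hv
  have hc : HasFDerivAt γ.chart (fderiv ℝ γ.chart (σ 0)) (σ 0) := by
    rw [h0]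
    exact ((γ.smooth_chart.contDiffAt (isOpen_ambient.mem_nhds
      (γ.param_mem_ambient u))).differentiableAt (by simp)).hasFDerivAt
  have h1 := hc.comp_hasDerivAt 0 hd
  have h2 : HasFDerivAt γ.param (γ.dparam u) ((γ.chart ∘ σ) 0) := by
    rw [Function.comp_apply, h0, chart_param]
    exact γ.hasFDerivAt_param u
  have h3 := h2.comp_hasDerivAt 0 h1
  have h4 : γ.param ∘ γ.chart ∘ σ =ᶠ[𝓝 0] σ := hS.mono fun s hs => γ.param_chart hs
  exact ⟨_, hd.unique (h3.congr_of_eventuallyEq h4.symm)⟩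

/-- The unit normal field of the hypersurface for which `deriv γ.t` is a principal curvature. -/
def normal (p : Amb n) : Amb n :=
  fun o => o.elim (-deriv γ.r (γ.parameter p)) fun i =>
    if i = 0 then p (some 0) * deriv γ.t (γ.parameter p) else 0

@[simp] lemma normal_param_none (u : Fin n → ℝ) :
    γ.normal (γ.param u) none = -deriv γ.r (u 0) := by
  simp [normal]

@[simp] lemma normal_param_zero (u : Fin n → ℝ) :
    γ.normal (γ.param u) (some 0) = Real.exp (γ.r (u 0)) * deriv γ.t (u 0) := by
  simp [normal]

lemma normal_of_ne (p : Amb n) {i : Fin n} (hi : i ≠ 0) : γ.normal p (some i) = 0 := by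
  simp [normal, hi]

lemma smooth_normal : ContDiffOn ℝ ∞ (γ.normal (n := n)) (ambient n) := by
  refine contDiffOn_pi.2 fun o => ?_
  rcases o with _ | i
  · exact (γ.smooth_deriv_r.comp_contDiffOn γ.smooth_parameter).neg
  · by_cases hi : i = 0
    · simpa [normal, hi] using (contDiff_apply ℝ ℝ (some 0)).contDiffOn.mul
        (γ.smooth_deriv_t.comp_contDiffOn γ.smooth_parameter)
    · simpa [normal, hi] using contDiffOn_const

/-- The derivative of `normal` along `param`. -/
lemma hasDerivAt_normal_param (u w : Fin n → ℝ) :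
    HasDerivAt (fun s : ℝ => γ.normal (γ.param (u + s • w)))
      (fun o => o.elim (-deriv (deriv γ.r) (u 0) * w 0) fun i => if i = 0 then
        Real.exp (γ.r (u 0)) * (deriv γ.r (u 0) * deriv γ.t (u 0) + deriv (deriv γ.t) (u 0)) * w 0
        else 0) 0 := by
  have h0 : HasDerivAt (fun s : ℝ => u 0 + s * w 0) (w 0) 0 := by
    simpa using ((hasDerivAt_id (0 : ℝ)).mul_const (w 0)).const_add (u 0)
  have hz : u 0 + 0 * w 0 = u 0 := by simp
  refine hasDerivAt_pi.2 fun o => ?_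
  rcases o with _ | i
  · have h1 := (hz ▸ γ.hasDerivAt_deriv_r (u 0)).fun_neg.comp (0 : ℝ) h0
    simpa [Function.comp_def] using h1
  · by_cases hi : i = 0
    · subst hi
      have h1 : HasDerivAt (fun s => Real.exp (γ.r s) * deriv γ.t s) _ (u 0 + 0 * w 0) :=
        hz ▸ ((γ.hasDerivAt_r (u 0)).exp.fun_mul (γ.hasDerivAt_deriv_t (u 0)))
      have h2 := h1.comp (0 : ℝ) h0
      simp only [normal_param_zero, Pi.add_apply, Pi.smul_apply, smul_eq_mul, Option.elim_some,
        if_true]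
      refine h2.congr_deriv ?_
      rw [hz]
      ring
    · simpa [γ.normal_of_ne _ hi, hi] using hasDerivAt_const (0 : ℝ) (0 : ℝ)

/-- The principal curvatures are `curv` along the profile and `t'` along the translations. Allowing
any field that is a multiple of `normal` on the hypersurface makes the formula apply to every unit
normal, whatever its extension. -/
lemma shape_eq_smul {N : Amb n → Amb n} {a : ℝ} {u : Fin n → ℝ}
    (hN : DifferentiableAt ℝ N (γ.param u)) (ha : ∀ v, N (γ.param v) = a • γ.normal (γ.param v))
    (w : Fin n → ℝ) :
    shape N (γ.param u) (γ.dparam u w) = a • γ.dparam u (fun i =>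
      if i = 0 then γ.curv (u 0) * w 0 else deriv γ.t (u 0) * w i) := by
  have h1 : HasDerivAt (fun s : ℝ => γ.param (u + s • w)) (γ.dparam u w) 0 := by
    have h1 : HasDerivAt (fun s : ℝ => u + s • w) w 0 := by
      simpa using ((hasDerivAt_id (0 : ℝ)).smul_const w).const_add u
    have h2 : HasFDerivAt γ.param (γ.dparam u) (u + (0 : ℝ) • w) := by
      simpa using γ.hasFDerivAt_param u
    exact h2.comp_hasDerivAt 0 h1
  have h2 : HasFDerivAt N (fderiv ℝ N (γ.param u)) (γ.param (u + (0 : ℝ) • w)) := by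
    simpa using hN.hasFDerivAt
  have h3 := h2.comp_hasDerivAt 0 h1
  have h4 := (γ.hasDerivAt_normal_param u w).const_smul a
  have h5 : N ∘ (fun s : ℝ => γ.param (u + s • w)) =
      fun s : ℝ => a • γ.normal (γ.param (u + s • w)) := funext fun s => ha _
  rw [h5] at h3
  -- The derivative of `N` in a tangent direction is determined by its values along the
  -- hypersurface.
  have h6 := h3.unique h4
  have he := (Real.exp_pos (γ.r (u 0))).ne'
  have hsum : ∑ i, γ.dparam u w (some i) * N (γ.param u) (some i) =
      a * (Real.exp (γ.r (u 0)) * deriv γ.r (u 0) * w 0 *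
        (Real.exp (γ.r (u 0)) * deriv γ.t (u 0))) := by
    rw [Finset.sum_eq_single 0]
    · simp [ha]; ring
    · intro i _ hi; simp [ha, γ.normal_of_ne _ hi]
    · simp
  rw [shape, covDeriv_ambMetric (γ.param_mem_ambient u), h6]
  funext o
  rcases o with _ | k
  · simp only [Pi.neg_apply, Pi.smul_apply, smul_eq_mul, Option.elim_none, dparam_none, if_true]
    linear_combination (-a * w 0) * γ.curv_mul_deriv_t (u 0)
  · by_cases hk : k = 0
    · subst hk
      simp only [hsum, Pi.neg_apply, Option.elim_some, if_true]
      simp only [Pi.smul_apply, smul_eq_mul, Option.elim_some, dparam_zero, if_true, ha, normal_param_zero, param_zero]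
      field_simp
      linear_combination (-a * w 0) * γ.curv_mul_deriv_r (u 0)
    · simp only [Pi.neg_apply, Pi.smul_apply, smul_eq_mul, Option.elim_some, dparam_zero,
        hk, if_false, ha, normal_param_zero, param_zero, γ.normal_of_ne _ hk, γ.dparam_of_ne _ _ hk]
      field_simp
      ring

lemma shape_normal (u w : Fin n → ℝ) :
    shape γ.normal (γ.param u) (γ.dparam u w) = γ.dparam u (fun i =>
      if i = 0 then γ.curv (u 0) * w 0 else deriv γ.t (u 0) * w i) := by
  have h := γ.shape_eq_smul (a := 1) (N := γ.normal) (u := u)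
    ((γ.smooth_normal.contDiffAt (isOpen_ambient.mem_nhds
      (γ.param_mem_ambient u))).differentiableAt (by simp)) (by simp) w
  simpa using h

lemma metricInner_normal (u : Fin n → ℝ) (v : Amb n) :
    metricInner (ambMetric n) (γ.param u) (γ.normal (γ.param u)) v =
      -deriv γ.r (u 0) * v none + deriv γ.t (u 0) / Real.exp (γ.r (u 0)) * v (some 0) := by
  rw [metricInner_ambMetric, Finset.sum_eq_single 0]
  · have he := (Real.exp_pos (γ.r (u 0))).ne'
    simp only [normal_param_none, normal_param_zero, param_zero]
    field_simp
  · intro i _ hi; simp [γ.normal_of_ne _ hi]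
  · simp

lemma isUnitNormal_normal : IsUnitNormal (γ.surface n) γ.normal where
  smooth := ⟨ambient n, isOpen_ambient, γ.surface_subset, γ.smooth_normal⟩
  unit := by
    rw [surface_eq_range]
    rintro _ ⟨u, rfl⟩
    have he := (Real.exp_pos (γ.r (u 0))).ne'
    rw [metricInner_normal, normal_param_none, normal_param_zero]
    field_simp
    linear_combination γ.unit_speed (u 0)
  normal := by
    intro p hp v hv
    rw [surface_eq_range] at hp
    obtain ⟨u, rfl⟩ := hp
    obtain ⟨w, rfl⟩ := γ.exists_of_isTangent hv
    have he := (Real.exp_pos (γ.r (u 0))).ne'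
    rw [metricInner_normal, dparam_none, dparam_zero]
    field_simp
    ring

lemma angle_normal (u : Fin n → ℝ) : angle γ.normal (γ.param u) = -deriv γ.r (u 0) := by
  rw [angle, metricInner_normal]
  simp [vert]

/-- A unit normal field is determined up to sign. -/
lemma exists_eq_smul_normal {N : Amb n → Amb n} (hN : IsUnitNormal (γ.surface n) N) :
    ∃ a : ℝ, ∀ u, N (γ.param u) = a • γ.normal (γ.param u) := by
  obtain ⟨W, hW, hSW, hNW⟩ := hN.smooth
  have hcont : Continuous fun u : Fin n → ℝ => N (γ.param u) :=
    hNW.continuousOn.comp_continuous γ.smooth_param.continuous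
      fun u => hSW (γ.param_mem_surface u)
  -- This is `⟨N, normal⟩`. Tangency conditions give `N = f · normal`, the unit length gives `f² =
  -- 1`, and continuity on a connected domain makes `f` constant.
  let f : (Fin n → ℝ) → ℝ := fun u =>
    deriv γ.t (u 0) / Real.exp (γ.r (u 0)) * N (γ.param u) (some 0)
      - deriv γ.r (u 0) * N (γ.param u) none
  have hf : Continuous f := by
    have h0 : Continuous fun u : Fin n → ℝ => u 0 := continuous_apply 0
    have h1 := γ.smooth_deriv_t.continuous.comp h0
    have h2 := γ.smooth_deriv_r.continuous.comp h0
    have h3 := (γ.smooth_r.continuous.comp h0).rexp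
    exact ((h1.div h3 fun u => (Real.exp_pos _).ne').mul ((continuous_apply _).comp hcont)).sub
      (h2.mul ((continuous_apply _).comp hcont))
  have hxi : ∀ u, ∀ i : Fin n, i ≠ 0 → N (γ.param u) (some i) = 0 := by
    intro u i hi
    have := hN.normal _ (γ.param_mem_surface u) _ (γ.isTangent_dparam u (Pi.single i 1))
    rw [metricInner_ambMetric, Finset.sum_eq_single i] at this
    · simpa [γ.dparam_of_ne u _ hi, Ne.symm hi, (Real.exp_pos (γ.r (u 0))).ne', hi] using this
    · intro j _ hj
      by_cases hj0 : j = 0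
      · simp [hj0, Ne.symm hi]
      · simp [γ.dparam_of_ne u _ hj0, hj]
    · simp
  have hs : ∀ u, deriv γ.t (u 0) * N (γ.param u) none
      + deriv γ.r (u 0) / Real.exp (γ.r (u 0)) * N (γ.param u) (some 0) = 0 := by
    intro u
    have := hN.normal _ (γ.param_mem_surface u) _ (γ.isTangent_dparam u (Pi.single 0 1))
    rw [metricInner_ambMetric, Finset.sum_eq_single 0] at this
    · simp only [dparam_none, dparam_zero, Pi.single_eq_same, param_zero, mul_one] at this
      rw [← this]
      have he := (Real.exp_pos (γ.r (u 0))).ne'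
      field_simp
    · intro j _ hj
      simp [hxi u j hj]
    · simp
  have hu : ∀ u, N (γ.param u) none ^ 2 + (N (γ.param u) (some 0) / Real.exp (γ.r (u 0))) ^ 2
      = 1 := by
    intro u
    have := hN.unit _ (γ.param_mem_surface u)
    rw [metricInner_ambMetric, Finset.sum_eq_single 0] at this
    · rw [← this, param_zero]; ring
    · intro j _ hj
      simp [hxi u j hj]
    · simp
  have hN0 : ∀ u, N (γ.param u) (some 0) = f u * (Real.exp (γ.r (u 0)) * deriv γ.t (u 0)) := by
    intro u
    have h1 := hs u
    have h2 := γ.unit_speed (u 0)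
    have he := (Real.exp_pos (γ.r (u 0))).ne'
    simp only [f]
    field_simp at h1 ⊢
    linear_combination (deriv γ.r (u 0)) * h1 - (N (γ.param u) (some 0)) * h2
  have hN1 : ∀ u, N (γ.param u) none = f u * (-deriv γ.r (u 0)) := by
    intro u
    have h1 := hs u
    have h2 := γ.unit_speed (u 0)
    have he := (Real.exp_pos (γ.r (u 0))).ne'
    simp only [f]
    field_simp at h1 ⊢
    linear_combination (deriv γ.t (u 0)) * h1
      - (N (γ.param u) none * Real.exp (γ.r (u 0))) * h2
  have hf2 : ∀ u, f u ^ 2 = 1 := by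
    intro u
    have h1 := hu u
    rw [hN0, hN1] at h1
    have he := (Real.exp_pos (γ.r (u 0))).ne'
    field_simp at h1
    linear_combination h1 - f u ^ 2 * γ.unit_speed (u 0)
  have hconst : ∀ u, f u = f 0 := by
    have h1 := isPreconnected_univ.eq_or_eq_neg_of_sq_eq (f := f) (g := fun _ => f 0)
      hf.continuousOn continuousOn_const
      (fun u _ => by simp [hf2]) (fun {_} _ h => by have := hf2 0; simp [h] at this)
    rcases h1 with h | h
    · exact fun u => h trivial
    · have := h (Set.mem_univ 0)
      simp only [Pi.neg_apply] at this
      have h2 := hf2 0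
      have : f 0 = 0 := by linarith
      simp [this] at h2
  refine ⟨f 0, fun u => ?_⟩
  funext o
  rcases o with _ | i
  · simp [hN1, hconst u]
  · by_cases hi : i = 0
    · subst hi; simp [hN0, hconst u]
    · simp [hxi u i hi, γ.normal_of_ne _ hi]

lemma sum_ite_zero (a b : ℝ) :
    (∑ i : Fin n, if i = 0 then a else b) = a + ((n : ℝ) - 1) * b := by
  have h : ∀ i : Fin n, (if i = 0 then a else b) = (if i = 0 then a - b else 0) + b := by
    intro i; split_ifs <;> ring
  simp only [h, Finset.sum_add_distrib, Finset.sum_ite_eq', Finset.mem_univ, if_true,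
    Finset.sum_const, Finset.card_univ, Fintype.card_fin, nsmul_eq_mul]
  ring

/-- The frame is `∂_s` together with `e^r ∂_{x_i}`. The Frenet equation turns `curv · t'` into
`r''`, and `t'² - 1 = -r'²` removes the remaining `t'`. -/
lemma isWeingartenS {c : ℝ} (hc : ∀ s, 2 * ((n : ℝ) - 1) * deriv (deriv γ.r) s
      - n * ((n : ℝ) - 1) * deriv γ.r s ^ 2 = c) : IsWeingartenS (γ.surface n) c := by
  refine ⟨γ.normal, γ.isUnitNormal_normal, ?_⟩
  intro p hp
  rw [surface_eq_range] at hp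
  obtain ⟨u, rfl⟩ := hp
  have hE : Real.exp (-(2 * γ.r (u 0))) * Real.exp (γ.r (u 0)) * Real.exp (γ.r (u 0)) = 1 := by
    rw [← Real.exp_add, ← Real.exp_add, Real.exp_eq_one_iff]; ring
  refine ⟨fun i => γ.dparam u (if i = 0 then Pi.single 0 1
      else Real.exp (γ.r (u 0)) • Pi.single i 1),
    fun i => if i = 0 then γ.curv (u 0) else deriv γ.t (u 0),
    fun i => γ.isTangent_dparam u _, fun i j => ?_, fun i => ?_, ?_⟩
  · rw [metricInner_dparam, metricInner_diagonal (g := warpedMetric γ.r) (p := u) rfl]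
    by_cases hij : i = j
    · subst hij
      by_cases hi : i = 0
      · simp [hi, Pi.single_apply]
      · simp [hi, Pi.single_apply]
        linear_combination hE
    · rw [if_neg hij]
      refine Finset.sum_eq_zero fun l _ => ?_
      by_cases hi : i = 0 <;> by_cases hj : j = 0 <;> by_cases hl : l = i <;>
        by_cases hl' : l = j <;> simp_all
  · rw [shape_normal, ← map_smul]
    congr 1
    funext l
    by_cases hi : i = 0 <;> by_cases hl : l = 0 <;> by_cases hli : l = i <;>
      simp_all
  · rw [angle_normal, weingartenS, sum_ite_ne_mul]
    simp only [ite_pow, sum_ite_zero]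
    rw [← hc (u 0)]
    linear_combination (2 * ((n : ℝ) - 1)) * γ.curv_mul_deriv_t (u 0)
      + ((n : ℝ) - 1) * ((n : ℝ) - 2) * γ.unit_speed (u 0)

lemma isConvexHypersurface (h1 : ∀ s, 0 ≤ γ.curv s) (h2 : ∀ s, 0 ≤ deriv γ.t s) :
    IsConvexHypersurface (γ.surface n) := by
  refine ⟨γ.normal, γ.isUnitNormal_normal, ?_⟩
  intro p hp k hk
  rw [surface_eq_range] at hp
  obtain ⟨u, rfl⟩ := hp
  obtain ⟨v, hv, hv0, hk⟩ := hk
  obtain ⟨w, rfl⟩ := γ.exists_of_isTangent hv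
  rw [shape_normal, ← map_smul] at hk
  have hk := γ.dparam_injective u hk
  have hw : w ≠ 0 := by rintro rfl; simp at hv0
  -- The shape operator is diagonal in these coordinates, so any nonzero coordinate of an
  -- eigenvector identifies its eigenvalue.
  obtain ⟨i, hi⟩ := Function.ne_iff.1 hw
  have h3 := congrFun hk i
  simp only [Pi.smul_apply, smul_eq_mul] at h3
  by_cases hi0 : i = 0
  · subst hi0
    rw [if_pos rfl] at h3
    exact mul_right_cancel₀ hi h3 ▸ h1 _
  · rw [if_neg hi0] at h3
    exact mul_right_cancel₀ hi h3 ▸ h2 _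

/-- The profile direction is principal with curvature zero, for either orientation. -/
lemma isNowhereStrictlyConvex (h : ∀ s, γ.curv s = 0) :
    IsNowhereStrictlyConvex (γ.surface n) := by
  intro p hp N hN hk
  rw [surface_eq_range] at hp
  obtain ⟨u, rfl⟩ := hp
  obtain ⟨a, ha⟩ := γ.exists_eq_smul_normal hN
  obtain ⟨W, hW, hSW, hNW⟩ := hN.smooth
  have hd : DifferentiableAt ℝ N (γ.param u) :=
    (hNW.contDiffAt (hW.mem_nhds (hSW (γ.param_mem_surface u)))).differentiableAt (by simp)
  refine lt_irrefl _ (hk 0 ⟨γ.dparam u (Pi.single 0 1), γ.isTangent_dparam u _, ?_, ?_⟩)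
  · intro h0
    have := γ.dparam_injective u (h0.trans (map_zero _).symm)
    simpa using congrFun this 0
  · rw [γ.shape_eq_smul hd ha, h]
    have : (fun i : Fin n => if i = 0 then 0 * (Pi.single 0 1 : Fin n → ℝ) 0
        else deriv γ.t (u 0) * (Pi.single 0 1 : Fin n → ℝ) i) = 0 := by
      funext i
      by_cases hi : i = 0 <;> simp [hi]
    rw [this]; simp

lemma isTotallyGeodesic (h1 : ∀ s, γ.curv s = 0) (h2 : ∀ s, deriv γ.t s = 0) :
    IsTotallyGeodesic (γ.surface n) := by
  refine ⟨γ.normal, γ.isUnitNormal_normal, ?_⟩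
  intro p hp v hv
  rw [surface_eq_range] at hp
  obtain ⟨u, rfl⟩ := hp
  obtain ⟨w, rfl⟩ := γ.exists_of_isTangent hv
  rw [shape_normal, h1, h2]
  have : (fun i : Fin n => if i = 0 then 0 * w 0 else 0 * w i) = 0 := by
    funext i; simp
  rw [this, map_zero]

lemma hasConstAngle {a : ℝ} (ha : ∀ s, deriv γ.r s = a) : HasConstAngle (γ.surface n) := by
  refine ⟨γ.normal, γ.isUnitNormal_normal, -a, ?_⟩
  rw [surface_eq_range]
  rintro _ ⟨u, rfl⟩
  rw [angle_normal, ha]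

end Profile

/-! ### The profile curves -/

lemma hasDerivAt_tanh (x : ℝ) : HasDerivAt Real.tanh (1 - Real.tanh x ^ 2) x := by
  have h := (Real.hasDerivAt_sinh x).fun_div (Real.hasDerivAt_cosh x) (Real.cosh_pos x).ne'
  simp only [← Real.tanh_eq_sinh_div_cosh] at h
  refine h.congr_deriv ?_
  have := (Real.cosh_pos x).ne'
  rw [Real.tanh_eq_sinh_div_cosh]
  field_simp

lemma contDiff_tanh : ContDiff ℝ ∞ Real.tanh := by
  have h : Real.tanh = fun x => Real.sinh x / Real.cosh x :=
    funext Real.tanh_eq_sinh_div_cosh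
  rw [h]
  exact Real.contDiff_sinh.div Real.contDiff_cosh fun x => (Real.cosh_pos x).ne'

lemma tanh_sq_lt_one (x : ℝ) : Real.tanh x ^ 2 < 1 := by
  have h := Real.cosh_sq x
  rw [Real.tanh_eq_sinh_div_cosh, div_pow, div_lt_one (by have := Real.cosh_pos x; positivity)]
  linarith

/-- The profile of an equidistant graph: a straight line. -/
def lineProfile (a b : ℝ) (h : a ^ 2 + b ^ 2 = 1) : Profile where
  r s := a * s
  t s := b * s
  G x := a * x.1 + b * x.2
  smooth_r := contDiff_const.mul contDiff_id
  smooth_t := contDiff_const.mul contDiff_id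
  smooth_G := (contDiff_const.mul contDiff_fst).add (contDiff_const.mul contDiff_snd)
  unit_speed s := by simpa [deriv_const_mul_field] using h
  left_inv s := by linear_combination s * h

/-- The logarithmic height `log y` of the symmetric profile. -/
def symR (n κ s : ℝ) : ℝ := -(2 / n) * Real.log (Real.cosh (n * κ / 2 * s))

lemma hasDerivAt_symR {n : ℝ} (hn : 0 < n) (κ s : ℝ) :
    HasDerivAt (symR n κ) (-κ * Real.tanh (n * κ / 2 * s)) s := by
  have h1 : HasDerivAt (fun s => n * κ / 2 * s) (n * κ / 2) s := by
    simpa using (hasDerivAt_id s).const_mul (n * κ / 2)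
  have h2 := ((h1.cosh).log (Real.cosh_pos _).ne').const_mul (-(2 / n))
  refine h2.congr_deriv ?_
  rw [Real.tanh_eq_sinh_div_cosh]
  field_simp

lemma deriv_symR {n : ℝ} (hn : 0 < n) (κ : ℝ) :
    deriv (symR n κ) = fun s => -κ * Real.tanh (n * κ / 2 * s) :=
  funext fun s => (hasDerivAt_symR hn κ s).deriv

lemma deriv_deriv_symR {n : ℝ} (hn : 0 < n) (κ s : ℝ) :
    deriv (deriv (symR n κ)) s = n / 2 * (deriv (symR n κ) s ^ 2 - κ ^ 2) := by
  rw [deriv_symR hn]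
  have h1 : HasDerivAt (fun s => n * κ / 2 * s) (n * κ / 2) s := by
    simpa using (hasDerivAt_id s).const_mul (n * κ / 2)
  have h2 := ((hasDerivAt_tanh (n * κ / 2 * s)).comp s h1).const_mul (-κ)
  have h3 : deriv (fun s => -κ * Real.tanh (n * κ / 2 * s)) s = _ := h2.deriv
  rw [h3]
  ring

lemma symR_zero (n κ : ℝ) : symR n κ 0 = 0 := by simp [symR]

lemma symR_neg (n κ s : ℝ) : symR n κ (-s) = symR n κ s := by simp [symR]

lemma contDiff_symR {n : ℝ} (κ : ℝ) : ContDiff ℝ ∞ (symR n κ) :=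
  contDiff_const.mul ((Real.contDiff_cosh.comp (contDiff_const.mul contDiff_id)).log
    fun _ => (Real.cosh_pos _).ne')

lemma symR_nonpos {n : ℝ} (hn : 0 < n) (κ s : ℝ) : symR n κ s ≤ 0 := by
  have := Real.log_nonneg (Real.one_le_cosh (n * κ / 2 * s))
  rw [symR, neg_mul]
  exact neg_nonpos.2 (by positivity)

lemma symR_antitoneOn {n κ : ℝ} (hn : 0 < n) (hκ : 0 < κ) :
    AntitoneOn (symR n κ) (Set.Ici 0) := by
  intro a ha b hb hab
  have h1 : Real.cosh (n * κ / 2 * a) ≤ Real.cosh (n * κ / 2 * b) := by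
    rw [Real.cosh_le_cosh, abs_of_nonneg (by have := Set.mem_Ici.1 ha; positivity),
      abs_of_nonneg (by have := Set.mem_Ici.1 hb; positivity)]
    gcongr
  have h2 := Real.log_le_log (Real.cosh_pos _) h1
  simp only [symR, neg_mul, neg_le_neg_iff]
  gcongr

lemma tendsto_symR {n κ : ℝ} (hn : 0 < n) (hκ : 0 < κ) :
    Tendsto (symR n κ) atTop atBot := by
  have h1 : Tendsto (fun s => n * κ / 2 * s) atTop atTop :=
    tendsto_id.const_mul_atTop (by positivity)
  have h2 : Tendsto (fun s => Real.log (Real.cosh (n * κ / 2 * s))) atTop atTop := by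
    refine Real.tendsto_log_atTop.comp (tendsto_atTop_mono (fun s => ?_)
      ((Real.tendsto_exp_atTop.comp h1).atTop_div_const (two_pos)))
    rw [Real.cosh_eq]
    have := (Real.exp_pos (-(n * κ / 2 * s))).le
    simp only [Function.comp_apply]
    gcongr
    linarith
  have h3 := h2.const_mul_atTop_of_neg (r := -(2 / n)) (by simp; positivity)
  exact h3

/-- The vertical speed of the symmetric profile. -/
def symSpeed (n κ s : ℝ) : ℝ := Real.sqrt (1 - κ ^ 2 * Real.tanh (n * κ / 2 * s) ^ 2)

/-- Strict positivity persists at `κ = 1` because `tanh² < 1`; this is what makes the square root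
smooth. -/
lemma symSpeed_sq_pos {κ : ℝ} (h0 : 0 < κ) (h1 : κ ≤ 1) (n s : ℝ) :
    0 < 1 - κ ^ 2 * Real.tanh (n * κ / 2 * s) ^ 2 := by
  have h2 := tanh_sq_lt_one (n * κ / 2 * s)
  have h3 : κ ^ 2 ≤ 1 := by nlinarith
  nlinarith [sq_nonneg (Real.tanh (n * κ / 2 * s)), sq_nonneg κ]

lemma symSpeed_pos {κ : ℝ} (h0 : 0 < κ) (h1 : κ ≤ 1) (n s : ℝ) : 0 < symSpeed n κ s :=
  Real.sqrt_pos.2 (symSpeed_sq_pos h0 h1 n s)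

lemma contDiff_symSpeed {κ : ℝ} (h0 : 0 < κ) (h1 : κ ≤ 1) (n : ℝ) :
    ContDiff ℝ ∞ (symSpeed n κ) :=
  (contDiff_const.sub (contDiff_const.mul
    ((contDiff_tanh.comp (contDiff_const.mul contDiff_id)).pow 2))).sqrt
    fun s => (symSpeed_sq_pos h0 h1 n s).ne'

lemma symSpeed_neg (n κ s : ℝ) : symSpeed n κ (-s) = symSpeed n κ s := by
  simp [symSpeed]

/-- For `κ < 1` this bound is positive and forces unbounded height; at `κ = 1` it degenerates. -/
lemma sqrt_le_symSpeed {κ : ℝ} (n s : ℝ) : Real.sqrt (1 - κ ^ 2) ≤ symSpeed n κ s := by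
  apply Real.sqrt_le_sqrt
  have h2 := tanh_sq_lt_one (n * κ / 2 * s)
  nlinarith [sq_nonneg κ]

lemma symSpeed_one (n s : ℝ) : symSpeed n 1 s = 1 / Real.cosh (n / 2 * s) := by
  have hc := Real.cosh_pos (n / 2 * s)
  rw [symSpeed, Real.sqrt_eq_iff_eq_sq (by simpa using (symSpeed_sq_pos one_pos le_rfl n s).le)
    (by positivity)]
  have := Real.cosh_sq (n / 2 * s)
  rw [Real.tanh_eq_sinh_div_cosh]
  simp only [mul_one, one_pow, one_mul]
  generalize n / 2 * s = x at *
  field_simp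
  linarith

lemma odd_of_deriv_even {f f' : ℝ → ℝ} (hf : ∀ s, HasDerivAt f (f' s) s) (h0 : f 0 = 0)
    (he : ∀ s, f' (-s) = f' s) (s : ℝ) : f (-s) = -f s := by
  have h1 : ∀ s, HasDerivAt (fun s => f (-s) + f s) 0 s := by
    intro s
    have h2 : HasDerivAt (fun s => f (-s)) (f' (-s) * -1) s :=
      (hf (-s)).comp s (hasDerivAt_neg s)
    refine (h2.fun_add (hf s)).congr_deriv ?_
    rw [he]; ring
  have h2 := is_const_of_deriv_eq_zero (fun s => (h1 s).differentiableAt)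
    (fun s => (h1 s).deriv) s 0
  simp only [neg_zero, h0, add_zero] at h2
  linarith

lemma unit_speed_sym {n κ : ℝ} (hn : 0 < n) (h0 : 0 < κ) (h1 : κ ≤ 1) (s : ℝ) :
    deriv (symR n κ) s ^ 2 + symSpeed n κ s ^ 2 = 1 := by
  rw [deriv_symR hn, symSpeed, Real.sq_sqrt (symSpeed_sq_pos h0 h1 n s).le]
  ring

/-- `f s - m s` is monotone, so `f` is pushed to both infinities by a line of slope `m`. -/
lemma surjective_of_le_deriv {f f' : ℝ → ℝ} {m : ℝ} (hm : 0 < m)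
    (hf : ∀ s, HasDerivAt f (f' s) s) (h : ∀ s, m ≤ f' s) : Function.Surjective f := by
  have hmono : Monotone fun s => f s - m * s := by
    refine monotone_of_deriv_nonneg
      (fun s => (((hf s).fun_sub ((hasDerivAt_id s).const_mul m))).differentiableAt) fun s => ?_
    have : deriv (fun s => f s - m * s) s = f' s - m * 1 :=
      ((hf s).fun_sub ((hasDerivAt_id s).const_mul m)).deriv
    rw [this]
    linarith [h s]
  have hc : Continuous f := continuous_iff_continuousAt.2 fun s => (hf s).continuousAt
  have hlin : Tendsto (fun s : ℝ => f 0 + m * s) atTop atTop :=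
    tendsto_atTop_add_const_left _ _ (tendsto_id.const_mul_atTop hm)
  have hlin' : Tendsto (fun s : ℝ => f 0 + m * s) atBot atBot :=
    tendsto_atBot_add_const_left _ _ (tendsto_id.const_mul_atBot hm)
  refine hc.surjective (tendsto_atTop_mono' _ ?_ hlin) (tendsto_atBot_mono' _ ?_ hlin')
  · filter_upwards [eventually_ge_atTop 0] with s hs
    have := hmono hs
    simp only [mul_zero, sub_zero] at this
    linarith
  · filter_upwards [eventually_le_atBot 0] with s hs
    have := hmono hs
    simp only [mul_zero, sub_zero] at this
    linarith

/-- A strictly increasing surjective smooth function, as a homeomorphism. -/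
lemma exists_homeomorph_of_deriv_pos {f f' : ℝ → ℝ} (hf : ∀ s, HasDerivAt f (f' s) s)
    (hpos : ∀ s, 0 < f' s) (hs : Function.Surjective f) : ∃ e : ℝ ≃ₜ ℝ, ∀ s, e s = f s := by
  have hmono : StrictMono f := strictMono_of_deriv_pos fun s => by
    rw [(hf s).deriv]; exact hpos s
  exact ⟨(StrictMono.orderIsoOfSurjective f hmono hs).toHomeomorph, fun s => rfl⟩

/-- The height is the primitive of `symSpeed`; it is a diffeomorphism of the line, so its inverse,
applied to the second coordinate, serves as the retraction. -/
lemma exists_symProfile_of_lt_one {n κ : ℝ} (hn : 0 < n) (h0 : 0 < κ) (h1 : κ < 1) :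
    ∃ γ : Profile, γ.r = symR n κ ∧ deriv γ.t = symSpeed n κ ∧ γ.t 0 = 0 := by
  let t : ℝ → ℝ := fun s => ∫ x in (0 : ℝ)..s, symSpeed n κ x
  have hcd := contDiff_symSpeed h0 h1.le n
  have ht : ∀ s, HasDerivAt t (symSpeed n κ s) s := fun s =>
    intervalIntegral.integral_hasDerivAt_right (hcd.continuous.intervalIntegrable _ _)
      (hcd.continuous.stronglyMeasurableAtFilter _ _) hcd.continuous.continuousAt
  have hdt : deriv t = symSpeed n κ := funext fun s => (ht s).deriv
  have hsm : ContDiff ℝ ∞ t :=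
    contDiff_infty_iff_deriv.2 ⟨fun s => (ht s).differentiableAt, hdt ▸ hcd⟩
  have hsurj := surjective_of_le_deriv (m := Real.sqrt (1 - κ ^ 2))
    (Real.sqrt_pos.2 (by nlinarith)) ht (fun s => sqrt_le_symSpeed n s)
  obtain ⟨e, he⟩ := exists_homeomorph_of_deriv_pos ht (symSpeed_pos h0 h1.le n) hsurj
  have hef : (e : ℝ → ℝ) = t := funext he
  have hes : ContDiff ℝ ∞ e.symm :=
    e.contDiff_symm_deriv (f' := symSpeed n κ) (fun s => (symSpeed_pos h0 h1.le n s).ne')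
      (by rw [hef]; exact ht) (by rw [hef]; exact hsm)
  refine ⟨⟨symR n κ, t, fun x => e.symm x.2, contDiff_symR κ, hsm, hes.comp contDiff_snd,
    fun s => ?_, fun s => ?_⟩, rfl, hdt, ?_⟩
  · rw [hdt]; exact unit_speed_sym hn h0 h1.le s
  · simp [← he]
  · simp [t]

lemma exists_symProfile_one {n : ℝ} (hn : 0 < n) :
    ∃ γ : Profile, γ.r = symR n 1 ∧ deriv γ.t = symSpeed n 1 ∧ γ.t 0 = 0 ∧
      Tendsto γ.t atTop (𝓝 (Real.pi / n)) ∧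
      ∀ s, γ.t s ∈ Set.Ioo (-(Real.pi / n)) (Real.pi / n) := by
  let t : ℝ → ℝ := fun s => 2 / n * Real.arctan (Real.sinh (n / 2 * s))
  have hx : ∀ s, HasDerivAt (fun s => n / 2 * s) (n / 2) s := fun s => by
    simpa using (hasDerivAt_id s).const_mul (n / 2)
  have hdt : deriv t = symSpeed n 1 := by
    funext s
    have h1 := ((hx s).sinh.arctan).const_mul (2 / n)
    have h2 : deriv t s = _ := h1.deriv
    rw [h2, symSpeed_one, add_comm 1, ← Real.cosh_sq]
    have := (Real.cosh_pos (n / 2 * s)).ne'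
    field_simp
  have hlin : ContDiff ℝ ∞ fun s : ℝ => n / 2 * s := contDiff_const.mul contDiff_id
  have hsm : ContDiff ℝ ∞ t :=
    contDiff_const.mul (Real.contDiff_arctan.comp (Real.contDiff_sinh.comp hlin))
  -- The height is bounded here, so its inverse is not defined on the whole line. On the curve
  -- `sin(nt/2) = tanh(ns/2)` and `e^{-nr/2} = cosh(ns/2)`; their product is `sinh(ns/2)`, which
  -- `arsinh` inverts globally.
  have hG : ContDiff ℝ ∞ fun x : ℝ × ℝ =>
      2 / n * Real.arsinh (Real.sin (n / 2 * x.2) * Real.exp (-(n / 2) * x.1)) :=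
    contDiff_const.mul (((Real.contDiff_sin.comp (contDiff_const.mul contDiff_snd)).mul
      (contDiff_const.mul contDiff_fst).exp).arsinh)
  refine ⟨⟨symR n 1, t, _, contDiff_symR 1, hsm, hG, fun s => ?_, fun s => ?_⟩, rfl, hdt, ?_, ?_,
    fun s => ?_⟩
  · rw [hdt]; exact unit_speed_sym hn one_pos le_rfl s
  · have hc := Real.cosh_pos (n / 2 * s)
    have e1 : n / 2 * t s = Real.arctan (Real.sinh (n / 2 * s)) := by
      simp only [t]; field_simp
    have e2 : -(n / 2) * symR n 1 s = Real.log (Real.cosh (n / 2 * s)) := by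
      simp only [symR, mul_one]; field_simp
    simp only [e1, e2]
    rw [Real.exp_log hc, Real.sin_arctan, add_comm 1, ← Real.cosh_sq, Real.sqrt_sq hc.le,
      div_mul_cancel₀ _ hc.ne', Real.arsinh_sinh]
    field_simp
  · simp [t]
  · have h1 : Tendsto (fun s => n / 2 * s) atTop atTop :=
      tendsto_id.const_mul_atTop (by positivity)
    have h2 : Tendsto (fun s => Real.sinh (n / 2 * s)) atTop atTop :=
      tendsto_atTop_mono' _ (by
        filter_upwards [eventually_ge_atTop 0] with s hs
        exact Real.self_le_sinh_iff.2 (by positivity)) h1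
    have h3 := ((Real.tendsto_arctan_atTop.mono_right nhdsWithin_le_nhds).comp h2).const_mul (2 / n)
    have e : 2 / n * (Real.pi / 2) = Real.pi / n := by field_simp
    rw [e] at h3
    exact h3
  · have e : Real.pi / n = 2 / n * (Real.pi / 2) := by field_simp
    have h2 : 0 < 2 / n := by positivity
    rw [e, ← mul_neg]
    exact ⟨mul_lt_mul_of_pos_left (Real.neg_pi_div_two_lt_arctan _) h2,
      mul_lt_mul_of_pos_left (Real.arctan_lt_pi_div_two _) h2⟩

/-- The symmetric profiles, for `0 < κ ≤ 1`. -/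
lemma exists_symProfile {n κ : ℝ} (hn : 0 < n) (h0 : 0 < κ) (h1 : κ ≤ 1) :
    ∃ γ : Profile, γ.r = symR n κ ∧ deriv γ.t = symSpeed n κ ∧ γ.t 0 = 0 ∧
      (κ = 1 → Tendsto γ.t atTop (𝓝 (Real.pi / n)) ∧
        ∀ s, γ.t s ∈ Set.Ioo (-(Real.pi / n)) (Real.pi / n)) := by
  rcases h1.lt_or_eq with h | rfl
  · obtain ⟨γ, hr, ht, hz⟩ := exists_symProfile_of_lt_one hn h0 h
    exact ⟨γ, hr, ht, hz, fun h' => absurd h' h.ne⟩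
  · obtain ⟨γ, hr, ht, hz, hlim⟩ := exists_symProfile_one hn
    exact ⟨γ, hr, ht, hz, fun _ => hlim⟩

/-! ### Convergence to the horocylinder -/

/-- Along a profile written as a graph `r = R(t)`, the slope `q = R'` satisfies
`q' = slopeField n (κ, q)`. -/
def slopeField (n : ℝ) (x : ℝ × ℝ) : ℝ :=
  n / 2 * (1 + x.2 ^ 2) * (x.2 ^ 2 - x.1 ^ 2 * (1 + x.2 ^ 2))

lemma contDiff_slopeField (n : ℝ) : ContDiff ℝ ∞ (slopeField n) := by
  unfold slopeField
  fun_prop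

/-- `R` is a function of slope `q`, with the initial value `R 0 = 0`, and `q` solves the profile
equation. -/
structure IsSlopeSolution (n κ : ℝ) (R q : ℝ → ℝ) : Prop where
  zero : R 0 = 0
  hasDerivAt : ∀ t, HasDerivAt R (q t) t
  hasDerivAt_slope : ∀ t, HasDerivAt q (slopeField n (κ, q t)) t

/-- Differentiating `F(κ, q)` along the equation gives `∂_q F · slopeField`, again smooth in `(κ,
q)` and zero at the origin. The function `F` does not depend on the solution, which makes the
estimate uniform in the family. Order zero is excluded since `R` itself is not a function of its
slope. -/
lemma exists_iteratedDeriv_eq (n : ℝ) (k : ℕ) : ∃ F : ℝ × ℝ → ℝ, ContDiff ℝ ∞ F ∧ F 0 = 0 ∧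
    ∀ κ R q, IsSlopeSolution n κ R q → ∀ t, iteratedDeriv (k + 1) R t = F (κ, q t) := by
  induction k with
  | zero =>
    refine ⟨fun x => x.2, contDiff_snd, rfl, fun κ R q h t => ?_⟩
    rw [zero_add, iteratedDeriv_one, (h.hasDerivAt t).deriv]
  | succ k ih =>
    obtain ⟨F, hF, -, hR⟩ := ih
    refine ⟨fun x => fderiv ℝ F x (0, slopeField n x), ?_, ?_, fun κ R q h t => ?_⟩
    · exact ((contDiff_infty_iff_fderiv.1 hF).2).clm_apply
        (contDiff_const.prodMk (contDiff_slopeField n))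
    · have h0 : ((0 : ℝ), slopeField n 0) = 0 := by simp [slopeField]
      simp only [h0, map_zero]
    · rw [iteratedDeriv_succ, funext (hR κ R q h)]
      have h1 : HasDerivAt (fun t => (κ, q t)) (0, slopeField n (κ, q t)) t :=
        (hasDerivAt_const t κ).prodMk (h.hasDerivAt_slope t)
      exact ((hF.differentiable (by simp) (κ, q t)).hasFDerivAt.comp_hasDerivAt t h1).deriv

lemma IsSlopeSolution.contDiff {n κ : ℝ} {R q : ℝ → ℝ} (h : IsSlopeSolution n κ R q) :
    ContDiff ℝ ∞ R := by
  refine contDiff_of_differentiable_iteratedDeriv fun m _ => ?_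
  rcases m with _ | k
  · rw [iteratedDeriv_zero]
    exact fun t => (h.hasDerivAt t).differentiableAt
  · obtain ⟨F, hF, -, hR⟩ := exists_iteratedDeriv_eq n k
    rw [funext (hR κ R q h)]
    exact (hF.differentiable (by simp)).comp ((differentiable_const κ).prodMk
      fun t => (h.hasDerivAt_slope t).differentiableAt)

lemma IsSlopeSolution.abs_le {n κ b : ℝ} {R q : ℝ → ℝ} (h : IsSlopeSolution n κ R q)
    (hb : ∀ t, |q t| ≤ b) (t : ℝ) : |R t| ≤ b * |t| := by
  have := Convex.norm_image_sub_le_of_norm_hasDerivWithin_le (f := R) (f' := q) (C := b)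
    (s := Set.univ) (x := 0) (y := t) (fun x _ => (h.hasDerivAt x).hasDerivWithinAt)
    (fun x _ => hb x) convex_univ trivial trivial
  simpa [h.zero] using this

section

variable {n : ℕ} [NeZero n]

lemma norm_iteratedFDeriv_comp_snd_le {R : ℝ → ℝ} (hR : ContDiff ℝ ∞ R) (k : ℕ)
    (x : CylCoord n) :
    ‖iteratedFDeriv ℝ k (fun x : CylCoord n => R x.2) x‖ ≤ |iteratedDeriv k R x.2| := by
  have h := ContinuousLinearMap.iteratedFDeriv_comp_right
    (ContinuousLinearMap.snd ℝ ({i : Fin n // i ≠ 0} → ℝ) ℝ) hR x (i := k)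
    (by exact_mod_cast le_top)
  have h' : iteratedFDeriv ℝ k (fun x : CylCoord n => R x.2) x = _ := h
  rw [h']
  refine (ContinuousMultilinearMap.norm_compContinuousLinearMap_le _ _).trans ?_
  rw [norm_iteratedFDeriv_eq_norm_iteratedDeriv, Real.norm_eq_abs]
  refine mul_le_of_le_one_right (abs_nonneg _) (Finset.prod_le_one (fun _ _ => norm_nonneg _)
    fun _ _ => ContinuousLinearMap.norm_snd_le _ _ _)

/-- Families of graphs `log y = R_c(t)` whose slopes solve the profile equation and tend to zero
converge to the horocylinder `{y = 1}`. -/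
lemma convergesToHorocylinder {S : ℝ → Set (Amb n)} {κ b : ℝ → ℝ} {R q : ℝ → ℝ → ℝ}
    (hκ : Tendsto κ (𝓝[<] 0) (𝓝 0)) (hb : Tendsto b (𝓝[<] 0) (𝓝 0))
    (hS : ∀ᶠ c in 𝓝[<] (0 : ℝ), S c = normalGraph 1 (fun x : CylCoord n => R c x.2))
    (hR : ∀ᶠ c in 𝓝[<] (0 : ℝ), IsSlopeSolution n (κ c) (R c) (q c))
    (hq : ∀ᶠ c in 𝓝[<] (0 : ℝ), ∀ t, |q c t| ≤ b c) :
    ConvergesToHorocylinder S 1 := by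
  refine ⟨fun c x => R c x.2, fun K _ _ => hS.mono fun c hc => by rw [hc],
    hR.mono fun c hc => hc.contDiff.comp contDiff_snd, fun k => ?_⟩
  rw [Metric.tendstoLocallyUniformly_iff]
  intro ε hε x
  -- Order zero is small only locally, through `|R t| ≤ b|t|`; the positive orders are small
  -- uniformly on the whole cylinder.
  rcases k with _ | k
  · refine ⟨Metric.ball x 1, Metric.ball_mem_nhds x one_pos, ?_⟩
    have h1 : Tendsto (fun c => b c * (‖x‖ + 1)) (𝓝[<] 0) (𝓝 0) := by
      simpa using hb.mul_const (‖x‖ + 1)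
    filter_upwards [hR, hq, h1.eventually (gt_mem_nhds hε)] with c hRc hqc hc y hy
    rw [Pi.zero_apply, dist_zero_left]
    refine (norm_iteratedFDeriv_comp_snd_le hRc.contDiff 0 y).trans_lt ?_
    rw [iteratedDeriv_zero]
    refine (hRc.abs_le hqc y.2).trans_lt (lt_of_le_of_lt ?_ hc)
    have h2 : |y.2| ≤ ‖x‖ + 1 := by
      have h3 : |y.2| ≤ ‖y‖ := norm_snd_le y
      have h4 : ‖y - x‖ < 1 := by rwa [← dist_eq_norm]
      have h5 := norm_le_norm_add_norm_sub' y x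
      linarith
    exact mul_le_mul_of_nonneg_left h2 ((abs_nonneg _).trans (hqc 0))
  · obtain ⟨F, hF, hF0, hRF⟩ := exists_iteratedDeriv_eq n k
    have h1 : ∀ᶠ z in 𝓝 (0 : ℝ × ℝ), |F z| < ε := by
      have : Tendsto (fun z => |F z|) (𝓝 0) (𝓝 0) := by
        simpa [hF0] using (hF.continuous.abs.tendsto (0 : ℝ × ℝ))
      exact this.eventually (gt_mem_nhds hε)
    obtain ⟨δ, hδ, hball⟩ := Metric.eventually_nhds_iff.1 h1
    refine ⟨Set.univ, univ_mem, ?_⟩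
    have hκ' : ∀ᶠ c in 𝓝[<] (0 : ℝ), |κ c| < δ := by
      have : Tendsto (fun c => |κ c|) (𝓝[<] 0) (𝓝 0) := by simpa using hκ.abs
      exact this.eventually (gt_mem_nhds hδ)
    filter_upwards [hR, hq, hκ', hb.eventually (gt_mem_nhds hδ)] with c hRc hqc hκc hbc y _
    rw [Pi.zero_apply, dist_zero_left]
    refine (norm_iteratedFDeriv_comp_snd_le hRc.contDiff _ y).trans_lt ?_
    rw [hRF _ _ _ hRc]
    apply hball
    rw [dist_zero_right, Prod.norm_def]
    exact max_lt hκc ((hqc y.2).trans_lt hbc)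

end

/-! ### Profiles as graphs over the height axis. -/

namespace Profile

variable (γ : Profile)

/-- A profile transverse to the horizontal direction is a graph `r = R(t)`. -/
lemma exists_isSlopeSolution {m κ : ℝ} (hκ : 0 ≤ κ) (hκ1 : κ < 1)
    (hode : ∀ s, deriv (deriv γ.r) s = m / 2 * (deriv γ.r s ^ 2 - κ ^ 2))
    (hp : ∀ s, |deriv γ.r s| ≤ κ) (ht : ∀ s, 0 < deriv γ.t s) (hr0 : γ.r 0 = 0)
    (ht0 : γ.t 0 = 0) (n : ℕ) [NeZero n] :
    ∃ R q : ℝ → ℝ, IsSlopeSolution m κ R q ∧ (∀ t, |q t| ≤ κ / Real.sqrt (1 - κ ^ 2)) ∧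
      γ.surface n = normalGraph 1 (fun x : CylCoord n => R x.2) := by
  have hpos : 0 < 1 - κ ^ 2 := by nlinarith
  have hτ : ∀ s, Real.sqrt (1 - κ ^ 2) ≤ deriv γ.t s := by
    intro s
    rw [Real.sqrt_le_left (ht s).le]
    have h1 := γ.unit_speed s
    have h2 : deriv γ.r s ^ 2 ≤ κ ^ 2 := sq_le_sq' (abs_le.1 (hp s)).1 (abs_le.1 (hp s)).2
    linarith
  have hsurj := surjective_of_le_deriv (Real.sqrt_pos.2 hpos) γ.hasDerivAt_t hτ
  obtain ⟨e, he⟩ := exists_homeomorph_of_deriv_pos γ.hasDerivAt_t ht hsurj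
  have hes : ∀ t, HasDerivAt e.symm (deriv γ.t (e.symm t))⁻¹ t := by
    intro t
    refine HasDerivAt.of_local_left_inverse e.symm.continuous.continuousAt
      (f := e) ?_ (ht _).ne' (.of_forall fun y => e.apply_symm_apply y)
    rw [show (e : ℝ → ℝ) = γ.t from funext he]
    exact γ.hasDerivAt_t _
  refine ⟨fun t => γ.r (e.symm t), fun t => deriv γ.r (e.symm t) / deriv γ.t (e.symm t),
    ⟨?_, fun t => ?_, fun t => ?_⟩, fun t => ?_, ?_⟩
  · have : e.symm 0 = 0 := by rw [e.symm_apply_eq, he, ht0]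
    simp [this, hr0]
  · exact (γ.hasDerivAt_r (e.symm t)).comp t (hes t)
  · have h1 := ((γ.hasDerivAt_deriv_r (e.symm t)).fun_div (γ.hasDerivAt_deriv_t (e.symm t))
      (ht _).ne').comp t (hes t)
    refine h1.congr_deriv ?_
    generalize e.symm t = s
    have hc : deriv (deriv γ.r) s * deriv γ.t s - deriv γ.r s * deriv (deriv γ.t) s
        = γ.curv s := by rw [curv]; ring
    have hct := γ.curv_mul_deriv_t s
    have hu := γ.unit_speed s
    have hne := (ht s).ne'
    rw [hc]
    have hcs : γ.curv s = deriv (deriv γ.r) s / deriv γ.t s := by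
      rw [← hct]; field_simp
    have hq : 1 + (deriv γ.r s / deriv γ.t s) ^ 2 = 1 / deriv γ.t s ^ 2 := by
      field_simp; linarith
    rw [hcs, hode, slopeField]
    simp only [hq]
    field_simp
  · rw [abs_div, abs_of_pos (ht _)]
    exact div_le_div₀ hκ (hp _) (Real.sqrt_pos.2 hpos) (hτ _)
  · ext p
    constructor
    · intro h
      refine ⟨γ.surface_subset h, ?_⟩
      obtain ⟨s, hs, hst⟩ := h
      simp [hs, hst, ← he]
    · rintro ⟨hp, h⟩
      refine ⟨e.symm (p none), ?_, ?_⟩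
      · simp only [div_one] at h
        rw [← h, Real.exp_log hp]
      · rw [← he, e.apply_symm_apply]

end Profile

/-! ### The two families -/

/-- The number `κ` with `c = -n (n - 1) κ²`. -/
def kappa (n : ℕ) (c : ℝ) : ℝ := Real.sqrt (-c / ((n : ℝ) * ((n : ℝ) - 1)))

lemma dim_pos {n : ℕ} (hn : 2 ≤ n) : 0 < (n : ℝ) * ((n : ℝ) - 1) := by
  have : (2 : ℝ) ≤ n := by exact_mod_cast hn
  have h1 : (0 : ℝ) < n - 1 := by linarith
  positivity

lemma kappa_sq {n : ℕ} (hn : 2 ≤ n) {c : ℝ} (hc : c < 0) :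
    kappa n c ^ 2 = -c / ((n : ℝ) * ((n : ℝ) - 1)) :=
  Real.sq_sqrt (div_pos (neg_pos.2 hc) (dim_pos hn)).le

lemma kappa_pos {n : ℕ} (hn : 2 ≤ n) {c : ℝ} (hc : c < 0) : 0 < kappa n c :=
  Real.sqrt_pos.2 (div_pos (neg_pos.2 hc) (dim_pos hn))

lemma kappa_le_one {n : ℕ} (hn : 2 ≤ n) {c : ℝ} (hc : -((n : ℝ) * ((n : ℝ) - 1)) ≤ c) :
    kappa n c ≤ 1 := by
  rw [kappa, Real.sqrt_le_left zero_le_one, one_pow, div_le_one (dim_pos hn)]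
  linarith

lemma kappa_lt_one {n : ℕ} (hn : 2 ≤ n) {c : ℝ} (hc : -((n : ℝ) * ((n : ℝ) - 1)) < c) :
    kappa n c < 1 := by
  rw [kappa, Real.sqrt_lt' one_pos, div_lt_iff₀ (dim_pos hn)]
  linarith

lemma kappa_eq_one {n : ℕ} (hn : 2 ≤ n) {c : ℝ} (hc : c = -((n : ℝ) * ((n : ℝ) - 1))) :
    kappa n c = 1 := by
  rw [kappa, hc, neg_neg, div_self (dim_pos hn).ne', Real.sqrt_one]

lemma tendsto_kappa (n : ℕ) : Tendsto (kappa n) (𝓝[<] 0) (𝓝 0) := by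
  have h : Continuous (kappa n) := by unfold kappa; fun_prop
  have := h.tendsto 0
  simp only [kappa, neg_zero, zero_div, Real.sqrt_zero] at this
  exact this.mono_left nhdsWithin_le_nhds

lemma tendsto_kappa_div (n : ℕ) :
    Tendsto (fun c => kappa n c / Real.sqrt (1 - kappa n c ^ 2)) (𝓝[<] 0) (𝓝 0) := by
  have h1 := ((tendsto_kappa n).pow 2).const_sub 1
  have h2 := (tendsto_kappa n).div h1.sqrt (by simp)
  rw [zero_pow two_ne_zero, sub_zero, Real.sqrt_one, zero_div] at h2
  exact h2

/-- The profile equation in terms of the scalar curvature. -/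
lemma scalar_of_ode {n : ℕ} (hn : 2 ≤ n) {c p p' : ℝ} (hc : c < 0)
    (h : p' = n / 2 * (p ^ 2 - kappa n c ^ 2)) :
    2 * ((n : ℝ) - 1) * p' - n * ((n : ℝ) - 1) * p ^ 2 = c := by
  rw [h, kappa_sq hn hc]
  have h1 := dim_pos hn
  have h2 : (n : ℝ) ≠ 0 := left_ne_zero_of_mul h1.ne'
  have h3 : (n : ℝ) - 1 ≠ 0 := right_ne_zero_of_mul h1.ne'
  field_simp
  ring

lemma sqrt_one_sub_sq {κ : ℝ} (h0 : 0 ≤ κ) (h1 : κ ≤ 1) :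
    κ ^ 2 + Real.sqrt (1 - κ ^ 2) ^ 2 = 1 := by
  rw [Real.sq_sqrt (by nlinarith)]; ring

/-! ### The equidistant graphs. -/

section Line

variable {a b : ℝ} (h : a ^ 2 + b ^ 2 = 1)

lemma deriv_lineProfile_r (s : ℝ) : deriv (lineProfile a b h).r s = a := by
  simp [lineProfile]

lemma deriv_lineProfile_t (s : ℝ) : deriv (lineProfile a b h).t s = b := by
  simp [lineProfile]

lemma curv_lineProfile (s : ℝ) : (lineProfile a b h).curv s = 0 := by
  rw [Profile.curv, funext (deriv_lineProfile_r h), funext (deriv_lineProfile_t h)]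
  simp

lemma deriv_deriv_lineProfile_r (s : ℝ) : deriv (deriv (lineProfile a b h).r) s = 0 := by
  rw [funext (deriv_lineProfile_r h)]
  simp

variable {n : ℕ} [NeZero n]

lemma surface_lineProfile (ha : a ≠ 0) : (lineProfile a b h).surface n =
    (fun q : Fin n → ℝ => pt q (b / a * Real.log (q 0))) '' hypSpace n := by
  ext p
  constructor
  · rintro ⟨s, hs, hst⟩
    refine ⟨fun i => p (some i), ?_, ?_⟩
    · show 0 < p (some 0)
      rw [hs]; exact Real.exp_pos _
    · funext o
      rcases o with _ | i
      · simp only [pt, Option.elim_none, hs, hst, Real.log_exp, lineProfile]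
        field_simp
      · rfl
  · rintro ⟨q, hq, rfl⟩
    refine ⟨Real.log (q 0) / a, ?_, ?_⟩
    · simp only [pt, Option.elim_some, lineProfile, mul_div_cancel₀ _ ha]
      rw [Real.exp_log hq]
    · simp only [pt, Option.elim_none, lineProfile]
      ring

lemma isEntireGraph_lineProfile (ha : a ≠ 0) : IsEntireGraph ((lineProfile a b h).surface n) :=
  ⟨_, contDiffOn_const.mul ((contDiff_apply ℝ ℝ 0).contDiffOn.log fun _ hq => ne_of_gt hq),
    surface_lineProfile h ha⟩

lemma surface_lineProfile_horizontal (ha : a ≠ 0) (hb : b = 0) :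
    (lineProfile a b h).surface n = horizontalHyperplane n 0 := by
  rw [surface_lineProfile h ha, hb]
  ext p
  simp only [zero_div, zero_mul]
  constructor
  · rintro ⟨q, hq, rfl⟩
    exact ⟨hq, rfl⟩
  · rintro ⟨hp, hp0⟩
    refine ⟨fun i => p (some i), hp, ?_⟩
    funext o
    rcases o with _ | i
    · exact hp0.symm
    · rfl

end Line

lemma surface_lineProfile_vertical (n : ℕ) [NeZero n] :
    (lineProfile 0 1 (by norm_num)).surface n = horocylinder n 1 := by
  ext p
  simp [Profile.surface, lineProfile, horocylinder]

lemma lineProfile_ode {n : ℕ} {κ b : ℝ} (h : κ ^ 2 + b ^ 2 = 1) (s : ℝ) :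
    deriv (deriv (lineProfile κ b h).r) s =
      n / 2 * (deriv (lineProfile κ b h).r s ^ 2 - κ ^ 2) := by
  rw [deriv_deriv_lineProfile_r, deriv_lineProfile_r]
  ring

/-! #### The symmetric family -/

/-- The profile has the form of the symmetric one. -/
structure IsSymProfile (n κ : ℝ) (γ : Profile) : Prop where
  r_eq : γ.r = symR n κ
  deriv_t : deriv γ.t = symSpeed n κ
  t_zero : γ.t 0 = 0
  limit : κ = 1 → Tendsto γ.t atTop (𝓝 (Real.pi / n)) ∧
    ∀ s, γ.t s ∈ Set.Ioo (-(Real.pi / n)) (Real.pi / n)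

namespace IsSymProfile

variable {n : ℕ} [NeZero n] {κ : ℝ} {γ : Profile}

lemma ode {n : ℝ} (h : IsSymProfile n κ γ) (hn : 0 < n) (s : ℝ) :
    deriv (deriv γ.r) s = n / 2 * (deriv γ.r s ^ 2 - κ ^ 2) := by
  rw [h.r_eq, deriv_deriv_symR hn]

lemma deriv_t_pos {n : ℝ} (h : IsSymProfile n κ γ) (h0 : 0 < κ) (h1 : κ ≤ 1) (s : ℝ) :
    0 < deriv γ.t s := by
  rw [h.deriv_t]; exact symSpeed_pos h0 h1 n s

lemma abs_deriv_r_le {n : ℝ} (h : IsSymProfile n κ γ) (hn : 0 < n) (h0 : 0 < κ) (s : ℝ) :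
    |deriv γ.r s| ≤ κ := by
  rw [h.r_eq, deriv_symR hn, abs_mul, abs_neg, abs_of_pos h0]
  exact mul_le_of_le_one_right h0.le ((sq_le_one_iff_abs_le_one _).1 (tanh_sq_lt_one _).le)

lemma t_neg {n : ℝ} (h : IsSymProfile n κ γ) (s : ℝ) : γ.t (-s) = -γ.t s :=
  odd_of_deriv_even γ.hasDerivAt_t h.t_zero (fun s => by rw [h.deriv_t, symSpeed_neg]) s

lemma strictMono_t {n : ℝ} (h : IsSymProfile n κ γ) (h0 : 0 < κ) (h1 : κ ≤ 1) :
    StrictMono γ.t :=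
  strictMono_of_deriv_pos (h.deriv_t_pos h0 h1)

lemma isSymmetricHorizontal (h : IsSymProfile n κ γ) :
    IsSymmetricHorizontal (γ.surface n) := by
  have key : ∀ (q : Fin n → ℝ) t, pt q t ∈ γ.surface n → pt q (-t) ∈ γ.surface n := by
    rintro q t ⟨s, hs, hst⟩
    refine ⟨-s, ?_, ?_⟩
    · rw [h.r_eq, symR_neg, ← h.r_eq]; exact hs
    · rw [h.t_neg]; exact congrArg Neg.neg hst
  refine fun q t => ⟨key q t, fun h' => ?_⟩
  simpa using key q (-t) h'

lemma surjective_t {n : ℝ} (h : IsSymProfile n κ γ) (h0 : 0 < κ) (h1 : κ < 1) :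
    Function.Surjective γ.t :=
  surjective_of_le_deriv (m := Real.sqrt (1 - κ ^ 2)) (Real.sqrt_pos.2 (by nlinarith))
    γ.hasDerivAt_t fun s => by rw [h.deriv_t]; exact sqrt_le_symSpeed n s

lemma image_height (hs : Function.Surjective γ.t) :
    (fun p : Amb n => p none) '' γ.surface n = Set.univ := by
  refine Set.eq_univ_of_forall fun t => ?_
  obtain ⟨s, rfl⟩ := hs t
  exact ⟨γ.param fun _ => s, γ.param_mem_surface _, rfl⟩

lemma mem_slab (h : IsSymProfile n κ γ) (h1 : κ = 1) {p : Amb n} (hp : p ∈ γ.surface n) :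
    p none ∈ Set.Ioo (-(Real.pi / n)) (Real.pi / n) := by
  obtain ⟨s, -, hs⟩ := hp
  rw [hs]
  exact (h.limit h1).2 s

lemma isAsymptoticTo_pos (h : IsSymProfile n 1 γ) :
    IsAsymptoticTo (γ.surface n ∩ {p | 0 < p none}) (Real.pi / n) := by
  have hn : (0 : ℝ) < n := by exact_mod_cast Nat.pos_of_ne_zero (NeZero.ne n)
  have hmono := h.strictMono_t one_pos le_rfl
  obtain ⟨hlim, hslab⟩ := h.limit rfl
  intro ε hε
  obtain ⟨s₀, hs₀, hs₀'⟩ := ((eventually_gt_atTop 0).and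
    (hlim.eventually (lt_mem_nhds (sub_lt_self _ hε)))).exists
  -- The parameter `s₀ > 0` is one beyond which the height is within `ε` of `π/n`. As `r` decreases
  -- to `-∞` for `s ≥ 0`, points of the upper part below `y = e^{r(s₀)}` have `s > s₀`, and the
  -- intermediate value theorem shows that they exist over every base point there.
  refine ⟨Real.exp (γ.r s₀), Real.exp_pos _, fun q hq hqδ => ⟨?_, ?_⟩⟩
  · have hlog : Real.log (q 0) ≤ γ.r s₀ := (Real.log_lt_iff_lt_exp hq).2 hqδ |>.le
    obtain ⟨s₁, hs₁, hs₁'⟩ := ((eventually_ge_atTop s₀).and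
      ((tendsto_symR hn one_pos).eventually (eventually_le_atBot (Real.log (q 0))))).exists
    rw [← h.r_eq] at hs₁'
    obtain ⟨s, hs, hsq⟩ := intermediate_value_Icc' hs₁ γ.smooth_r.continuous.continuousOn
      ⟨hs₁', hlog⟩
    refine ⟨γ.t s, ⟨s, ?_, rfl⟩, ?_⟩
    · rw [hsq, Real.exp_log hq]; rfl
    · show 0 < γ.t s
      rw [← h.t_zero]
      exact hmono (hs₀.trans_le hs.1)
  · rintro t ⟨⟨s, hs, hst⟩, ht⟩
    have hst : t = γ.t s := hst
    have ht : 0 < t := ht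
    have hs : q 0 = Real.exp (γ.r s) := hs
    have hspos : 0 < s := hmono.lt_iff_lt.1 (by rw [h.t_zero, ← hst]; exact ht)
    have hlt : s₀ < s := by
      by_contra hle
      have h2 := symR_antitoneOn hn one_pos (Set.mem_Ici.2 hspos.le) (Set.mem_Ici.2 hs₀.le)
        (not_lt.1 hle)
      rw [← h.r_eq] at h2
      rw [hs] at hqδ
      exact absurd (Real.exp_lt_exp.1 hqδ) (not_lt.2 h2)
    have h3 := hmono hlt
    have h4 := (hslab s).2
    rw [hst, abs_lt]
    constructor <;> linarith

lemma isAsymptoticTo_neg (h : IsSymProfile n 1 γ) :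
    IsAsymptoticTo (γ.surface n ∩ {p | p none < 0}) (-(Real.pi / n)) := by
  intro ε hε
  obtain ⟨δ, hδ, H⟩ := h.isAsymptoticTo_pos ε hε
  refine ⟨δ, hδ, fun q hq hqδ => ?_⟩
  obtain ⟨⟨t, ht, ht0⟩, H2⟩ := H q hq hqδ
  have ht0 : 0 < t := ht0
  refine ⟨⟨-t, (h.isSymmetricHorizontal q t).1 ht, ?_⟩, ?_⟩
  · show -t < 0
    linarith
  · rintro t' ⟨ht', ht0'⟩
    have ht0' : t' < 0 := ht0'
    have := H2 (-t') ⟨(h.isSymmetricHorizontal q t').1 ht', by show 0 < -t'; linarith⟩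
    rw [← abs_neg]
    convert this using 2
    ring

/-- The symmetric hypersurface stays in `{y ≤ 1}`, whereas a line with `a > 0` leaves it. -/
lemma surface_ne_surface_lineProfile (h : IsSymProfile n κ γ) {a b : ℝ} (ha : 0 < a)
    (hab : a ^ 2 + b ^ 2 = 1) : (lineProfile a b hab).surface n ≠ γ.surface n := by
  intro heq
  have h1 := (lineProfile a b hab).param_mem_surface (fun _ : Fin n => 1)
  rw [heq] at h1
  obtain ⟨s, hs, -⟩ := h1
  rw [Profile.param_zero, Real.exp_eq_exp, h.r_eq] at hs
  have hn : (0 : ℝ) < n := by exact_mod_cast Nat.pos_of_ne_zero (NeZero.ne n)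
  have h2 := symR_nonpos hn κ s
  rw [← hs] at h2
  simp only [lineProfile, mul_one] at h2
  linarith

end IsSymProfile

end HxR

end

/-! ### Assembly of the two families. -/

theorem mainTheorem7 (n : ℕ) [NeZero n] (hn : 3 ≤ n) :
    ∃ S₁ S₂ : ℝ → Set (HxR.Amb n),
      (∀ c ∈ Set.Ico (-((n : ℝ) * ((n : ℝ) - 1))) 0,
        S₁ c ≠ S₂ c ∧
        (∀ S ∈ ({S₁ c, S₂ c} : Set (Set (HxR.Amb n))),
          HxR.IsProperlyEmbeddedHypersurface S ∧
          HxR.IsWeingartenS S c ∧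
          HxR.HasConstScalarCurvature S c ∧
          Nonempty (S ≃ₜ EuclideanSpace ℝ (Fin n)) ∧
          HxR.IsParabolicInvariant S) ∧
        (HxR.IsConvexHypersurface (S₁ c) ∧
          HxR.IsNowhereStrictlyConvex (S₁ c) ∧
          HxR.IsEntireGraph (S₁ c) ∧
          HxR.HasConstSectionalCurvature (S₁ c) (c / ((n : ℝ) * ((n : ℝ) - 1))) ∧
          HxR.HasConstAngle (S₁ c) ∧
          (c = -((n : ℝ) * ((n : ℝ) - 1)) →
            (∃ h : ℝ, S₁ c = HxR.horizontalHyperplane n h) ∧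
            HxR.IsTotallyGeodesic (S₁ c) ∧
            HxR.HasConstSectionalCurvature (S₁ c) (-1))) ∧
        (HxR.IsSymmetricHorizontal (S₂ c) ∧
          (-((n : ℝ) * ((n : ℝ) - 1)) < c →
            ¬ BddAbove ((fun p => p none) '' S₂ c) ∧ ¬ BddBelow ((fun p => p none) '' S₂ c)) ∧
          (c = -((n : ℝ) * ((n : ℝ) - 1)) →
            (∀ p ∈ S₂ c, p none ∈ Set.Ioo (-(Real.pi / n)) (Real.pi / n)) ∧
            HxR.IsAsymptoticTo (S₂ c ∩ {p | 0 < p none}) (Real.pi / n) ∧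
            HxR.IsAsymptoticTo (S₂ c ∩ {p | p none < 0}) (-(Real.pi / n))))) ∧
      ∃ a > 0,
        HxR.HasConstSectionalCurvature (HxR.horocylinder n a) 0 ∧
        HxR.ConvergesToHorocylinder S₁ a ∧
        HxR.ConvergesToHorocylinder S₂ a := by
  have hn2 : 2 ≤ n := by omega
  have hnpos : (0 : ℝ) < n := by exact_mod_cast (by omega : 0 < n)
  -- The families must be defined for every real `c`; outside the admissible interval the profile is
  -- an arbitrary default.
  have hline : ∀ c : ℝ, ∃ γ : HxR.Profile, c ∈ Set.Ico (-((n : ℝ) * ((n : ℝ) - 1))) 0 →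
      ∃ h : HxR.kappa n c ^ 2 + Real.sqrt (1 - HxR.kappa n c ^ 2) ^ 2 = 1,
        γ = HxR.lineProfile _ _ h := by
    intro c
    by_cases hc : c ∈ Set.Ico (-((n : ℝ) * ((n : ℝ) - 1))) 0
    · exact ⟨_, fun _ => ⟨HxR.sqrt_one_sub_sq (HxR.kappa_pos hn2 hc.2).le
        (HxR.kappa_le_one hn2 hc.1), rfl⟩⟩
    · exact ⟨HxR.lineProfile 0 1 (by norm_num), fun h => absurd h hc⟩
  have hsym : ∀ c : ℝ, ∃ γ : HxR.Profile, c ∈ Set.Ico (-((n : ℝ) * ((n : ℝ) - 1))) 0 →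
      HxR.IsSymProfile n (HxR.kappa n c) γ := by
    intro c
    by_cases hc : c ∈ Set.Ico (-((n : ℝ) * ((n : ℝ) - 1))) 0
    · obtain ⟨γ, h1, h2, h3, h4⟩ := HxR.exists_symProfile hnpos (HxR.kappa_pos hn2 hc.2)
        (HxR.kappa_le_one hn2 hc.1)
      exact ⟨γ, fun _ => ⟨h1, h2, h3, h4⟩⟩
    · exact ⟨HxR.lineProfile 0 1 (by norm_num), fun h => absurd h hc⟩
  choose γ₁ hγ₁ using hline
  choose γ₂ hγ₂ using hsym
  have hev : ∀ᶠ c in 𝓝[<] (0 : ℝ), c ∈ Set.Ioo (-((n : ℝ) * ((n : ℝ) - 1))) 0 :=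
    Ioo_mem_nhdsLT (neg_lt_zero.2 (HxR.dim_pos hn2))
  refine ⟨fun c => (γ₁ c).surface n, fun c => (γ₂ c).surface n, fun c hc => ?_, 1, one_pos, ?_,
    ?_, ?_⟩
  · have hκ := HxR.kappa_pos hn2 hc.2
    have hκ1 := HxR.kappa_le_one hn2 hc.1
    obtain ⟨h, hγ⟩ := hγ₁ c hc
    have hs := hγ₂ c hc
    have hode₁ : ∀ s, 2 * ((n : ℝ) - 1) * deriv (deriv (γ₁ c).r) s
        - n * ((n : ℝ) - 1) * deriv (γ₁ c).r s ^ 2 = c := fun s =>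
      HxR.scalar_of_ode hn2 hc.2 (by rw [hγ]; exact HxR.lineProfile_ode h s)
    have hode₂ : ∀ s, 2 * ((n : ℝ) - 1) * deriv (deriv (γ₂ c).r) s
        - n * ((n : ℝ) - 1) * deriv (γ₂ c).r s ^ 2 = c := fun s =>
      HxR.scalar_of_ode hn2 hc.2 (hs.ode hnpos s)
    have hr : ∀ s, deriv (γ₁ c).r s = HxR.kappa n c := by
      rw [hγ]; exact HxR.deriv_lineProfile_r h
    have hcurv : ∀ s, (γ₁ c).curv s = 0 := by rw [hγ]; exact HxR.curv_lineProfile h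
    have ht : ∀ s, deriv (γ₁ c).t s = Real.sqrt (1 - HxR.kappa n c ^ 2) := by
      rw [hγ]; exact HxR.deriv_lineProfile_t h
    have hsec : HxR.HasConstSectionalCurvature ((γ₁ c).surface n)
        (c / ((n : ℝ) * ((n : ℝ) - 1))) := by
      have h1 := (γ₁ c).hasConstSectionalCurvature (n := n) hr
      rwa [HxR.kappa_sq hn2 hc.2, ← neg_div, neg_neg] at h1
    refine ⟨?_, ?_, ⟨?_, ?_, ?_, hsec, ?_, fun hce => ⟨⟨0, ?_⟩, ?_, ?_⟩⟩,
      ⟨hs.isSymmetricHorizontal, fun hlt => ?_, fun hce => ?_⟩⟩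
    · simp only [hγ]
      exact hs.surface_ne_surface_lineProfile hκ h
    · intro S hS
      have key : ∀ γ : HxR.Profile, (∀ s, 2 * ((n : ℝ) - 1) * deriv (deriv γ.r) s
          - n * ((n : ℝ) - 1) * deriv γ.r s ^ 2 = c) →
          HxR.IsProperlyEmbeddedHypersurface (γ.surface n) ∧ HxR.IsWeingartenS (γ.surface n) c ∧
          HxR.HasConstScalarCurvature (γ.surface n) c ∧
          Nonempty (γ.surface n ≃ₜ EuclideanSpace ℝ (Fin n)) ∧
          HxR.IsParabolicInvariant (γ.surface n) := fun γ hγ =>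
        ⟨γ.isProperlyEmbedded, γ.isWeingartenS hγ, γ.hasConstScalarCurvature hγ,
          γ.homeomorph_euclideanSpace, γ.isParabolicInvariant⟩
      rcases hS with rfl | rfl
      exacts [key _ hode₁, key _ hode₂]
    · exact (γ₁ c).isConvexHypersurface (fun s => (hcurv s).ge)
        (fun s => by rw [ht]; exact Real.sqrt_nonneg _)
    · exact (γ₁ c).isNowhereStrictlyConvex hcurv
    · simp only [hγ]
      exact HxR.isEntireGraph_lineProfile h hκ.ne'
    · exact (γ₁ c).hasConstAngle hr
    · simp only [hγ]
      exact HxR.surface_lineProfile_horizontal h hκ.ne' (by simp [HxR.kappa_eq_one hn2 hce])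
    · exact (γ₁ c).isTotallyGeodesic hcurv
        (fun s => by rw [ht, HxR.kappa_eq_one hn2 hce]; simp)
    · have h1 := (γ₁ c).hasConstSectionalCurvature (n := n) hr
      rwa [HxR.kappa_eq_one hn2 hce, one_pow] at h1
    · rw [HxR.IsSymProfile.image_height (hs.surjective_t hκ (HxR.kappa_lt_one hn2 hlt))]
      exact ⟨not_bddAbove_univ, not_bddBelow_univ⟩
    · have hone := HxR.kappa_eq_one hn2 hce
      refine ⟨fun p hp => hs.mem_slab hone hp, ?_, ?_⟩
      · rw [hone] at hs; exact hs.isAsymptoticTo_pos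
      · rw [hone] at hs; exact hs.isAsymptoticTo_neg
  · have h1 := (HxR.lineProfile 0 1 (by norm_num)).hasConstSectionalCurvature (n := n)
      (HxR.deriv_lineProfile_r (by norm_num))
    rw [HxR.surface_lineProfile_vertical] at h1
    simpa using h1
  -- The left endpoint is dropped because a graph over the whole height axis needs `κ < 1`; values
  -- of `c` near `0` are all that matter.
  · have hex : ∀ c, ∃ R q : ℝ → ℝ, c ∈ Set.Ioo (-((n : ℝ) * ((n : ℝ) - 1))) 0 →
        HxR.IsSlopeSolution n (HxR.kappa n c) R q ∧
        (∀ t, |q t| ≤ HxR.kappa n c / Real.sqrt (1 - HxR.kappa n c ^ 2)) ∧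
        (γ₁ c).surface n = HxR.normalGraph 1 (fun x : HxR.CylCoord n => R x.2) := by
      intro c
      by_cases hc : c ∈ Set.Ioo (-((n : ℝ) * ((n : ℝ) - 1))) 0
      · obtain ⟨h, hγ⟩ := hγ₁ c ⟨hc.1.le, hc.2⟩
        have hκ := HxR.kappa_pos hn2 hc.2
        have hκ1 := HxR.kappa_lt_one hn2 hc.1
        obtain ⟨R, q, h1⟩ := (γ₁ c).exists_isSlopeSolution (m := n) hκ.le hκ1
          (by rw [hγ]; exact HxR.lineProfile_ode h)
          (fun s => by rw [hγ, HxR.deriv_lineProfile_r, abs_of_pos hκ])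
          (fun s => by
            rw [hγ, HxR.deriv_lineProfile_t]; exact Real.sqrt_pos.2 (by nlinarith))
          (by simp [hγ, HxR.lineProfile]) (by simp [hγ, HxR.lineProfile]) n
        exact ⟨R, q, fun _ => h1⟩
      · exact ⟨0, 0, fun h => absurd h hc⟩
    choose R q hRq using hex
    exact HxR.convergesToHorocylinder (HxR.tendsto_kappa n) (HxR.tendsto_kappa_div n)
      (hev.mono fun c hc => (hRq c hc).2.2) (hev.mono fun c hc => (hRq c hc).1)
      (hev.mono fun c hc => (hRq c hc).2.1)
  · have hex : ∀ c, ∃ R q : ℝ → ℝ, c ∈ Set.Ioo (-((n : ℝ) * ((n : ℝ) - 1))) 0 →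
        HxR.IsSlopeSolution n (HxR.kappa n c) R q ∧
        (∀ t, |q t| ≤ HxR.kappa n c / Real.sqrt (1 - HxR.kappa n c ^ 2)) ∧
        (γ₂ c).surface n = HxR.normalGraph 1 (fun x : HxR.CylCoord n => R x.2) := by
      intro c
      by_cases hc : c ∈ Set.Ioo (-((n : ℝ) * ((n : ℝ) - 1))) 0
      · have hs := hγ₂ c ⟨hc.1.le, hc.2⟩
        have hκ := HxR.kappa_pos hn2 hc.2
        have hκ1 := HxR.kappa_lt_one hn2 hc.1
        obtain ⟨R, q, h1⟩ := (γ₂ c).exists_isSlopeSolution (m := n) hκ.le hκ1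
          (hs.ode hnpos) (hs.abs_deriv_r_le hnpos hκ) (hs.deriv_t_pos hκ hκ1.le)
          (by rw [hs.r_eq]; exact HxR.symR_zero _ _) hs.t_zero n
        exact ⟨R, q, fun _ => h1⟩
      · exact ⟨0, 0, fun h => absurd h hc⟩
    choose R q hRq using hex
    exact HxR.convergesToHorocylinder (HxR.tendsto_kappa n) (HxR.tendsto_kappa_div n)
      (hev.mono fun c hc => (hRq c hc).2.2) (hev.mono fun c hc => (hRq c hc).1)
      (hev.mono fun c hc => (hRq c hc).2.1)
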